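/- **Theorem 1.** Let $(M,g)$ be a smooth finite-dimensional Lorentzian manifold with signature $(+,\dots,+,-)$ and Levi-Civita connection $\nabla$, and let $i:\Sigma\to M$ be a smooth immersed $2$-dimensional timelike submanifold, i.e. $g$ restricts to a Lorentzian form on every tangent space $T_p\Sigma$ (self-intersections are allowed). A vector field *on* (an open subset of) $\Sigma$ is tangent to $\Sigma$; all fields and curves are smooth. Let $n$ be a vector field on an open set $U\subseteq\Sigma$ with $g(n,n)=-1$. Near each point of $U$ there is a vector field $\tau$ on $\Sigma$, unique up to sign, with $g(\tau,\tau)=1$ and $g(n,\tau)=0$. A particle worldline $\lambda$ in $U$ is a curve in $U$, defined on an open interval, whose tangent $u=\dot\lambda$ satisfies $g(u,u)=-1$. Its spatial velocity $v\in(-1,1)$ with respect to $n$ is given by $u=\gamma(n+v\tau)$, $\gamma=1/\sqrt{1-v^2}$ (so $u$ lies in the same time cone as $n$). Its Coriolis and centrifugal accelerations with respect to $n$ are $$a_{\mathrm{Cor}}=-\gamma^2v\,\big(\nabla_n\tau+\nabla_\tau n+g(\nabla_n\tau,n)\,n-g(\nabla_\tau n,\tau)\,\tau\big),$$ $$a_{\mathrm{cen}}=-\gamma^2v^2\,\big(\nabla_\tau\tau+\nabla_nn+g(\nabla_\tau\tau,n)\,n-g(\nabla_nn,\tau)\,\tau\big);$$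 they do not depend on the sign of $\tau$. For an open set $U\subseteq\Sigma$ consider the following properties: * $(\mathrm{i})_U$ For every particle worldline in $U$, the centrifugal and Coriolis accelerations with respect to every vector field $n$ on $U$ with $g(n,n)=-1$ vanish. * $(\mathrm{ii})_U$ $U$ is generated by two congruences of lightlike geodesics: there are two vector fields $l_1,l_2$ on $U$, lightlike (and nowhere zero) and linearly independent at every point, all of whose integral curves are, up to parametrization, geodesics of $(M,g)$, i.e. satisfy $\nabla_{\dot c}\dot c=q\,\dot c$ with some scalar $q$. * $(\mathrm{iii})_U$ For any two vector fields $n,\tau$ on $U$ with $g(\tau,\tau)=-g(n,n)=1$ and $g(n,\tau)=0$, the field $\tau$ is Fermi–Walker parallel along $n$, i.e. $\nabla_n\tau$ is a multiple of $n$. Then: 1. The following are equivalent: (i) $(\mathrm{i})_U$ holds for all open $U\subseteq\Sigma$; (ii) every point of $\Sigma$ has an open neighbourhood $U$ with $(\mathrm{ii})_U$; (iii) $(\mathrm{iii})_U$ holds for all open $U\subseteq\Sigma$. 2. If $\Sigma$ admits globally defined vector fields $n,\tau$ with $g(\tau,\tau)=-g(n,n)=1$ and $g(n,\tau)=0$,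 then $(\mathrm{i})_\Sigma$, $(\mathrm{ii})_\Sigma$ and $(\mathrm{iii})_\Sigma$ are equivalent. -/

import Mathlib

open scoped Manifold ContDiff Bundle

noncomputable section

namespace PhotonSurface

/-- A symmetric bilinear form of signature `(+, …, +, -)`: some vector is timelike, and the form is
positive definite on the orthogonal complement of that vector. -/
def IsLorentzForm {V : Type*} [AddCommGroup V] [Module ℝ V] (B : V → V → ℝ) : Prop :=
  (∀ v w, B v w = B w v) ∧ ∃ v, B v v < 0 ∧ ∀ w, w ≠ 0 → B v w = 0 → 0 < B w w

section Ambient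

variable {E : Type*} [NormedAddCommGroup E] [NormedSpace ℝ E]
  {M : Type*} [TopologicalSpace M] [ChartedSpace E M] [IsManifold 𝓘(ℝ, E) ∞ M]

variable (E M) in
/-- A smooth Lorentzian metric on the manifold `M`. -/
structure LorentzMetric where
  /-- The scalar product on each tangent space. -/
  val (x : M) : TangentSpace 𝓘(ℝ, E) x →L[ℝ] TangentSpace 𝓘(ℝ, E) x →L[ℝ] ℝ
  lorentz (x : M) : IsLorentzForm (fun v w : TangentSpace 𝓘(ℝ, E) x => val x v w)
  contMDiff : ContMDiff 𝓘(ℝ, E) (𝓘(ℝ, E).prod 𝓘(ℝ, E →L[ℝ] E →L[ℝ] ℝ)) ∞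
    (fun x => Bundle.TotalSpace.mk' (E →L[ℝ] E →L[ℝ] ℝ)
      (E := fun x : M => TangentSpace 𝓘(ℝ, E) x →L[ℝ] TangentSpace 𝓘(ℝ, E) x →L[ℝ] ℝ) x (val x))

/-- The metric at `x` as a bilinear form on the model space `E`, which is the tangent space at `x`
in the preferred chart at `x`. -/
def LorentzMetric.form (g : LorentzMetric E M) (x : M) : E →L[ℝ] E →L[ℝ] ℝ := g.val x

/-- The same as a form without topology. -/
def LorentzMetric.bilin (g : LorentzMetric E M) (x : M) : LinearMap.BilinForm ℝ E :=
  LinearMap.mk₂ ℝ (fun v w : E => g.form x v w)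
    (fun _ _ _ => by simp) (fun _ _ _ => by simp) (fun _ _ _ => by simp) (fun _ _ _ => by simp)

theorem LorentzMetric.bilin_nondegenerate (g : LorentzMetric E M) (x : M) :
    (g.bilin x).Nondegenerate := by
  have h : IsLorentzForm (fun v w : E => g.form x v w) := g.lorentz x
  obtain ⟨hs, v, hv, hpos⟩ := h
  have key : ∀ w : E, (∀ u : E, g.form x w u = 0) → w = 0 := by
    intro w hw
    by_contra hne
    exact (hpos w hne ((hs v w).trans (hw v))).ne' (hw w)
  exact ⟨key, fun w hw => key w fun u => (hs w u).trans (hw u)⟩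

/-- The components of the metric near `x` in the preferred chart at `x`, as a function on `M`
with values in the bilinear forms on `E`. -/
def LorentzMetric.coord (g : LorentzMetric E M) (x : M) (y : M) : E →L[ℝ] E →L[ℝ] ℝ :=
  let T : E →L[ℝ] E := (trivializationAt E (TangentSpace 𝓘(ℝ, E) : M → Type _) x).symmL ℝ y
  (g.form y).bilinearComp T T

/-- The derivative at `x` of the metric components `coord g x` in the preferred chart at `x`;
`dCoord g x a b d` is `∂_a g(b, d)`. -/
def LorentzMetric.dCoord (g : LorentzMetric E M) (x : M) : E →L[ℝ] E →L[ℝ] E →L[ℝ] ℝ :=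
  mfderiv 𝓘(ℝ, E) 𝓘(ℝ, E →L[ℝ] E →L[ℝ] ℝ) (g.coord x) x

/-- The Christoffel symbols of the first kind at `x` in the preferred chart at `x`,
`(a, b) ↦ (d ↦ (∂_a g(b, d) + ∂_b g(a, d) - ∂_d g(a, b)) / 2)`. -/
def LorentzMetric.christoffelFirst (g : LorentzMetric E M) (x : M) (a b : E) :
    Module.Dual ℝ E where
  toFun d := (g.dCoord x a b d + g.dCoord x b a d - g.dCoord x d a b) / 2
  map_add' d d' := by
    rw [map_add (g.dCoord x a b), map_add (g.dCoord x b a), (g.dCoord x).map_add,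
      add_apply, add_apply]
    ring
  map_smul' r d := by
    rw [map_smul (g.dCoord x a b), map_smul (g.dCoord x b a), (g.dCoord x).map_smul,
      smul_apply, smul_apply]
    simp only [smul_eq_mul, RingHom.id_apply]
    ring

variable [FiniteDimensional ℝ E]

/-- The Christoffel symbols of the Levi-Civita connection at `x` in the preferred chart at `x`:
`christoffel g x a b` is the vector `Γ` with `g(Γ, d) = christoffelFirst g x a b d` for all `d`. -/
def LorentzMetric.christoffel (g : LorentzMetric E M) (x : M) (a b : E) : E :=
  ((g.bilin x).toDual (g.bilin_nondegenerate x)).symm (g.christoffelFirst x a b)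

/-- The Levi-Civita covariant derivative at `p`, in the direction of the tangent vector `w` of `N`,
of a vector field `Y` along a map `f : N → M`. It is computed in the preferred chart of `M` at
`f p` as `∂_w Y + Γ(df w, Y)`. -/
def LorentzMetric.covDeriv (g : LorentzMetric E M)
    {F : Type*} [NormedAddCommGroup F] [NormedSpace ℝ F]
    {N : Type*} [TopologicalSpace N] [ChartedSpace F N]
    (f : N → M) (Y : (p : N) → TangentSpace 𝓘(ℝ, E) (f p)) (p : N) (w : TangentSpace 𝓘(ℝ, F) p) :
    TangentSpace 𝓘(ℝ, E) (f p) :=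
  let y : N → E := fun q => (trivializationAt E (TangentSpace 𝓘(ℝ, E) : M → Type _) (f p)
    (⟨f q, Y q⟩ : TangentBundle 𝓘(ℝ, E) M)).2
  let dy : E := mfderiv 𝓘(ℝ, F) 𝓘(ℝ, E) y p w
  dy + g.christoffel (f p) (mfderiv 𝓘(ℝ, F) 𝓘(ℝ, E) f p w) (Y p)

/-- The velocity vector at parameter `t` of a curve in a manifold. -/
def velocity {F : Type*} [NormedAddCommGroup F] [NormedSpace ℝ F]
    {N : Type*} [TopologicalSpace N] [ChartedSpace F N] (c : ℝ → N) (t : ℝ) :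
    TangentSpace 𝓘(ℝ, F) (c t) :=
  mfderiv 𝓘(ℝ, ℝ) 𝓘(ℝ, F) c t (1 : ℝ)

/-- On the set `J` of parameters the curve `c` is a geodesic of `M`, not necessarily affinely
parametrized: `∇_ċ ċ` is a multiple of the nowhere vanishing velocity `ċ`. -/
def LorentzMetric.IsGeodesicOn (g : LorentzMetric E M) (c : ℝ → M) (J : Set ℝ) : Prop :=
  ∀ t ∈ J, velocity (F := E) c t ≠ 0 ∧
    ∃ q : ℝ, g.covDeriv (F := ℝ) c (fun s => velocity (F := E) c s) t (1 : ℝ)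
      = q • velocity (F := E) c t

end Ambient

section Surface

/-- The model space of surfaces. -/
abbrev Plane : Type := EuclideanSpace ℝ (Fin 2)

variable {E : Type*} [NormedAddCommGroup E] [NormedSpace ℝ E] [FiniteDimensional ℝ E]
  {M : Type*} [TopologicalSpace M] [ChartedSpace E M] [IsManifold 𝓘(ℝ, E) ∞ M]
  {S : Type*} [TopologicalSpace S] [ChartedSpace Plane S] [IsManifold 𝓘(ℝ, Plane) ∞ S]

/-- The vector `di(v)` of `M` that corresponds to the tangent vector `v` of the surface. -/
def push (E : Type*) [NormedAddCommGroup E] [NormedSpace ℝ E] {M : Type*} [TopologicalSpace M]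
    [ChartedSpace E M] {S : Type*} [TopologicalSpace S] [ChartedSpace Plane S]
    (i : S → M) (p : S) (v : TangentSpace 𝓘(ℝ, Plane) p) : TangentSpace 𝓘(ℝ, E) (i p) :=
  mfderiv 𝓘(ℝ, Plane) 𝓘(ℝ, E) i p v

/-- The metric of `M` evaluated on tangent vectors of the surface. -/
def LorentzMetric.induced (g : LorentzMetric E M) (i : S → M) (p : S)
    (v w : TangentSpace 𝓘(ℝ, Plane) p) : ℝ :=
  g.val (i p) (push E i p v) (push E i p w)

/-- `i : S → M` is a timelike immersed submanifold of dimension two: a smooth immersion for which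
the metric restricts to a Lorentzian form on every tangent space of `S`. -/
structure IsTimelikeSurface (g : LorentzMetric E M) (i : S → M) : Prop where
  immersion : Manifold.IsImmersion 𝓘(ℝ, Plane) 𝓘(ℝ, E) ∞ i
  timelike (p : S) : IsLorentzForm (g.induced i p)

/-- `n` is a smooth tangent vector field on the subset `U` of the surface. -/
def IsVectorFieldOn (U : Set S) (n : (p : S) → TangentSpace 𝓘(ℝ, Plane) p) : Prop :=
  ContMDiffOn 𝓘(ℝ, Plane) 𝓘(ℝ, Plane).tangent ∞
    (fun p => (⟨p, n p⟩ : TangentBundle 𝓘(ℝ, Plane) S)) U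

/-- An observer field on `U`: a smooth vector field on `U` with `g(n, n) = -1`. -/
def IsObserverField (g : LorentzMetric E M) (i : S → M) (U : Set S)
    (n : (p : S) → TangentSpace 𝓘(ℝ, Plane) p) : Prop :=
  IsVectorFieldOn U n ∧ ∀ p ∈ U, g.induced i p (n p) (n p) = -1

/-- `n` and `τ` are smooth vector fields on `U` with `g(τ, τ) = -g(n, n) = 1`, `g(n, τ) = 0`. -/
def IsOrthonormalPair (g : LorentzMetric E M) (i : S → M) (U : Set S)
    (n τ : (p : S) → TangentSpace 𝓘(ℝ, Plane) p) : Prop :=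
  IsObserverField g i U n ∧ IsVectorFieldOn U τ ∧
    ∀ p ∈ U, g.induced i p (τ p) (τ p) = 1 ∧ g.induced i p (n p) (τ p) = 0

/-- `∇_m w` for tangent vector fields `m`, `w` on the surface, a vector field along the surface. -/
def LorentzMetric.nabla (g : LorentzMetric E M) (i : S → M)
    (m w : (p : S) → TangentSpace 𝓘(ℝ, Plane) p) (p : S) : TangentSpace 𝓘(ℝ, E) (i p) :=
  g.covDeriv i (fun q => push E i q (w q)) p (m p)

/-- A particle worldline in the surface: a smooth curve on an open interval `J`, parametrized such
that `g(u, u) = -1` for its velocity `u`. -/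
structure IsWorldline (g : LorentzMetric E M) (i : S → M) (J : Set ℝ) (c : ℝ → S) : Prop where
  isOpen : IsOpen J
  ordConnected : J.OrdConnected
  contMDiffOn : ContMDiffOn 𝓘(ℝ, ℝ) 𝓘(ℝ, Plane) ∞ c J
  normalized : ∀ t ∈ J, g.induced i (c t) (velocity (F := Plane) c t) (velocity (F := Plane) c t) = -1

/-- The Lorentz factor `γ = 1 / √(1 - v²)`. -/
def lorentzFactor (v : ℝ) : ℝ := 1 / √(1 - v ^ 2)

/-- `v` is the spatial velocity with respect to `(n, τ)` of a particle at `p` with four-velocity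
`u`: `u = γ (n + v τ)` and `-1 < v < 1`. -/
def IsSpatialVelocity (n τ : (p : S) → TangentSpace 𝓘(ℝ, Plane) p) (p : S)
    (u : TangentSpace 𝓘(ℝ, Plane) p) (v : ℝ) : Prop :=
  -1 < v ∧ v < 1 ∧ u = lorentzFactor v • (n p + v • τ p)

/-- The Coriolis acceleration at `p` of a particle with spatial velocity `v`:
`-γ² v (∇_n τ + ∇_τ n + g(∇_n τ, n) n - g(∇_τ n, τ) τ)`. -/
def LorentzMetric.coriolis (g : LorentzMetric E M) (i : S → M)
    (n τ : (p : S) → TangentSpace 𝓘(ℝ, Plane) p) (p : S) (v : ℝ) : TangentSpace 𝓘(ℝ, E) (i p) :=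
  -(lorentzFactor v ^ 2 * v) • (g.nabla i n τ p + g.nabla i τ n p
    + g.val (i p) (g.nabla i n τ p) (push E i p (n p)) • push E i p (n p)
    - g.val (i p) (g.nabla i τ n p) (push E i p (τ p)) • push E i p (τ p))

/-- The centrifugal acceleration at `p` of a particle with spatial velocity `v`:
`-γ² v² (∇_τ τ + ∇_n n + g(∇_τ τ, n) n - g(∇_n n, τ) τ)`. -/
def LorentzMetric.centrifugal (g : LorentzMetric E M) (i : S → M)
    (n τ : (p : S) → TangentSpace 𝓘(ℝ, Plane) p) (p : S) (v : ℝ) : TangentSpace 𝓘(ℝ, E) (i p) :=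
  -(lorentzFactor v ^ 2 * v ^ 2) • (g.nabla i τ τ p + g.nabla i n n p
    + g.val (i p) (g.nabla i τ τ p) (push E i p (n p)) • push E i p (n p)
    - g.val (i p) (g.nabla i n n p) (push E i p (τ p)) • push E i p (τ p))

/-- For every worldline in `U` the centrifugal and Coriolis accelerations with respect to every
observer field `n` on `U` vanish. The field `τ` completing `n` to an orthonormal pair, which is
unique up to a sign that does not affect these accelerations, is only needed near the point
considered. -/
def NoCentrifugalCoriolis (g : LorentzMetric E M) (i : S → M) (U : Set S) : Prop :=
  ∀ n : (p : S) → TangentSpace 𝓘(ℝ, Plane) p, IsObserverField g i U n →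
  ∀ (J : Set ℝ) (c : ℝ → S), IsWorldline g i J c → Set.MapsTo c J U →
  ∀ t ∈ J, ∀ V : Set S, IsOpen V → V ⊆ U → c t ∈ V →
  ∀ τ : (p : S) → TangentSpace 𝓘(ℝ, Plane) p, IsOrthonormalPair g i V n τ →
  ∀ v : ℝ, IsSpatialVelocity n τ (c t) (velocity (F := Plane) c t) v →
    g.centrifugal i n τ (c t) v = 0 ∧ g.coriolis i n τ (c t) v = 0

/-- The integral curves of the vector field `l` in `U` form a congruence of lightlike geodesics
of `M`. -/
def IsLightlikeGeodesicCongruence (g : LorentzMetric E M) (i : S → M) (U : Set S)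
    (l : (p : S) → TangentSpace 𝓘(ℝ, Plane) p) : Prop :=
  IsVectorFieldOn U l ∧ (∀ p ∈ U, l p ≠ 0 ∧ g.induced i p (l p) (l p) = 0) ∧
    ∀ (J : Set ℝ) (c : ℝ → S), IsOpen J → J.OrdConnected → Set.MapsTo c J U →
      IsMIntegralCurveOn (I := 𝓘(ℝ, Plane)) c l J → g.IsGeodesicOn (fun t => i (c t)) J

/-- `U` is generated by two (everywhere distinct) congruences of lightlike geodesics of `M`. -/
def IsGeneratedByLightlikeGeodesics (g : LorentzMetric E M) (i : S → M) (U : Set S) : Prop :=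
  ∃ l₁ l₂ : (p : S) → TangentSpace 𝓘(ℝ, Plane) p,
    IsLightlikeGeodesicCongruence g i U l₁ ∧ IsLightlikeGeodesicCongruence g i U l₂ ∧
      ∀ p ∈ U, LinearIndependent ℝ ![l₁ p, l₂ p]

/-- For every orthonormal pair `(n, τ)` on `U`, the field `τ` is Fermi-Walker parallel along `n`,
that is, `∇_n τ` is a multiple of `n`. -/
def FermiWalkerParallel (g : LorentzMetric E M) (i : S → M) (U : Set S) : Prop :=
  ∀ n τ : (p : S) → TangentSpace 𝓘(ℝ, Plane) p, IsOrthonormalPair g i U n τ →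
    ∀ p ∈ U, ∃ r : ℝ, g.nabla i n τ p = r • push E i p (n p)

end Surface

end PhotonSurface

end

/-! All the conditions reduce to one pointwise condition, `IsPhotonPoint`: the second fundamental
form II vanishes on lightlike vectors. Modulo vectors tangent to the surface, `∇_m w` equals
`ambientHessian` at the values of `m` and `w` (`nabla_eq`), which is symmetric and bilinear. In an
orthonormal frame the lightlike directions are `n ± τ`, so by polarization the condition says `II(n,
τ) = 0` and `II(n, n) + II(τ, τ) = 0` (`IsOrthonormalAt.isPhotonPoint_iff`).

Modulo tangent vectors the Coriolis bracket is `2 II(n, τ)` and the centrifugal bracket is `II(n, n)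
+ II(τ, τ)`. When these vanish, the correction terms cancel the remaining tangential parts exactly,
because `g(∇n, n) = g(∇τ, τ) = 0` by metric compatibility. This settles (i), given one worldline of
nonzero velocity through each point.

For (ii), the acceleration of an integral curve of `l` is `∇_l l`. If these curves are geodesics
then `II(l, l) = 0`, and two independent lightlike directions suffice. Conversely, for `l = n ± τ`
the vector `∇_l l` is tangent and orthogonal to `l`, hence a multiple of `l`.

For (iii), `∇_n τ` has no `τ`-component, so Fermi–Walker parallelism means `II(n, τ) = 0`. Demanding
this also for a boosted frame yields the second equation. Frames exist locally by Gram–Schmidt,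
which gives the local equivalence; the global one uses the given frame. -/

noncomputable section

set_option maxSynthPendingDepth 3
set_option linter.unusedSectionVars false

namespace PhotonSurface

open Filter Topology Set

/-! ### Chain rule -/

section Calculus

/-- Chain rule for a function of two maps from a manifold to vector spaces. -/
theorem hasMFDerivAt_comp_prodMk {F A B C : Type*} [NormedAddCommGroup F] [NormedSpace ℝ F]
    [NormedAddCommGroup A] [NormedSpace ℝ A] [NormedAddCommGroup B] [NormedSpace ℝ B]
    [NormedAddCommGroup C] [NormedSpace ℝ C]
    {N : Type*} [TopologicalSpace N] [ChartedSpace F N] {p : N}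
    {a : N → A} {b : N → B} {a' : F →L[ℝ] A} {b' : F →L[ℝ] B}
    {K : A × B → C} {K' : A × B →L[ℝ] C}
    (hK : HasFDerivAt K K' (a p, b p)) (ha : HasMFDerivAt 𝓘(ℝ, F) 𝓘(ℝ, A) a p a')
    (hb : HasMFDerivAt 𝓘(ℝ, F) 𝓘(ℝ, B) b p b') :
    HasMFDerivAt 𝓘(ℝ, F) 𝓘(ℝ, C) (fun q => K (a q, b q)) p (K'.comp (a'.prod b')) := by
  have h : HasMFDerivAt 𝓘(ℝ, F) 𝓘(ℝ, A × B) (fun q => (a q, b q)) p (a'.prod b') :=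
    ⟨ha.1.prodMk hb.1, ha.2.prodMk hb.2⟩
  exact hK.hasMFDerivAt.comp p h

end Calculus

/-! ### The Levi-Civita connection in chart components -/

section Coordinates

variable {E : Type*} [NormedAddCommGroup E] [NormedSpace ℝ E]
  {M : Type*} [TopologicalSpace M] [ChartedSpace E M] [IsManifold 𝓘(ℝ, E) ∞ M]

/-- The components of the tangent vector `v` at `y` in the preferred chart at `x`. -/
def components (x y : M) (v : E) : E :=
  (trivializationAt E (TangentSpace 𝓘(ℝ, E) : M → Type _) x
    (⟨y, v⟩ : TangentBundle 𝓘(ℝ, E) M)).2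

theorem components_eq_mfderiv {x y : M} (hy : y ∈ (chartAt E x).source) (v : E) :
    components x y v = mfderiv 𝓘(ℝ, E) 𝓘(ℝ, E) (extChartAt 𝓘(ℝ, E) x) y v := by
  have : IsManifold 𝓘(ℝ, E) 1 M := .of_le (n := ∞) (by simp)
  rw [← TangentBundle.continuousLinearMapAt_trivializationAt hy]
  have hb : y ∈ (trivializationAt E (TangentSpace 𝓘(ℝ, E) : M → Type _) x).baseSet := by
    simpa using hy
  exact (congrFun (Bundle.Trivialization.coe_linearMapAt_of_mem (R := ℝ) _ hb) v).symm

theorem components_self (x : M) (v : E) : components x x v = v := by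
  have : IsManifold 𝓘(ℝ, E) 1 M := .of_le (n := ∞) (by simp)
  rw [components_eq_mfderiv (mem_chart_source E x), mfderiv_extChartAt_self]
  rfl

theorem coord_components (g : LorentzMetric E M) {x y : M} (hy : y ∈ (chartAt E x).source)
    (v w : E) : g.coord x y (components x y v) (components x y w) = g.form y v w := by
  have : IsManifold 𝓘(ℝ, E) 1 M := .of_le (n := ∞) (by simp)
  have key : ∀ v : E, (trivializationAt E (TangentSpace 𝓘(ℝ, E) : M → Type _) x).symmL ℝ y
      (components x y v) = v := by
    intro v
    have hb : y ∈ (trivializationAt E (TangentSpace 𝓘(ℝ, E) : M → Type _) x).baseSet := by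
      simpa using hy
    have := (trivializationAt E (TangentSpace 𝓘(ℝ, E) : M → Type _) x).symmL_continuousLinearMapAt
      (R := ℝ) hb v
    refine Eq.trans ?_ this
    exact congrArg (Bundle.Trivialization.symmL ℝ _ y)
      (congrFun (Bundle.Trivialization.coe_linearMapAt_of_mem (R := ℝ) _ hb) v).symm
  exact congrArg₂ (fun a b : E => g.form y a b) (key v) (key w)

theorem coord_self (g : LorentzMetric E M) (x : M) : g.coord x x = g.form x := by
  ext v w
  have := coord_components g (mem_chart_source E x) v w
  rwa [components_self, components_self] at this

theorem coord_symm (g : LorentzMetric E M) (x y : M) (v w : E) :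
    g.coord x y v w = g.coord x y w v :=
  (g.lorentz y).1 _ _

/-- Smoothness of a section of the bundle of bilinear forms means smoothness of its local
expression, and near `x` that expression is `g.coord x`. -/
theorem contMDiffAt_coord (g : LorentzMetric E M) (x : M) :
    ContMDiffAt 𝓘(ℝ, E) 𝓘(ℝ, E →L[ℝ] E →L[ℝ] ℝ) ∞ (g.coord x) x := by
  have h := g.contMDiff x
  rw [contMDiffAt_hom_bundle] at h
  refine h.2.congr_of_eventuallyEq ?_
  filter_upwards [(chartAt E x).open_source.mem_nhds (mem_chart_source E x)] with y hy
  have hb : y ∈ (trivializationAt E (TangentSpace 𝓘(ℝ, E) : M → Type _) x).baseSet := by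
    simpa using hy
  ext v w
  refine Eq.trans ?_ (inCoordinates_apply_eq₂ (F₃ := ℝ) (E₃ := fun _ : M => ℝ) hb hb
    (Set.mem_univ _)).symm
  have hT : Bundle.Trivialization.linearMapAt ℝ
      (trivializationAt ℝ (fun _ : M => ℝ) x) y = LinearMap.id :=
    Bundle.Trivial.linearMapAt_trivialization ℝ M ℝ y
  rw [hT, ← Bundle.Trivialization.symmL_apply (R := ℝ) _ hb,
    ← Bundle.Trivialization.symmL_apply (R := ℝ) _ hb]
  rfl

theorem hasMFDerivAt_coord (g : LorentzMetric E M) (x : M) :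
    HasMFDerivAt 𝓘(ℝ, E) 𝓘(ℝ, E →L[ℝ] E →L[ℝ] ℝ) (g.coord x) x (g.dCoord x) :=
  ((contMDiffAt_coord g x).mdifferentiableAt (by simp)).hasMFDerivAt

/-- Swapping arguments is a continuous linear map that fixes `g.coord x`, so by the chain rule it
fixes the derivative. -/
theorem dCoord_symm (g : LorentzMetric E M) (x : M) (a b d : E) :
    g.dCoord x a b d = g.dCoord x a d b := by
  let K : (E →L[ℝ] E →L[ℝ] ℝ) →L[ℝ] (E →L[ℝ] E →L[ℝ] ℝ) :=
    (ContinuousLinearMap.flipₗᵢ ℝ E E ℝ).toContinuousLinearEquiv.toContinuousLinearMap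
  have h1 := (K.hasFDerivAt (x := g.coord x x)).hasMFDerivAt.comp x (hasMFDerivAt_coord g x)
  have h2 : K ∘ g.coord x = g.coord x := by
    funext y; ext v w
    exact coord_symm g x y w v
  rw [h2] at h1
  have h3 := hasMFDerivAt_unique h1 (hasMFDerivAt_coord g x)
  have h4 : K (g.dCoord x a) = g.dCoord x a := congrArg (fun T : E →L[ℝ] E →L[ℝ] E →L[ℝ] ℝ => T a) h3
  exact (congrArg (fun T : E →L[ℝ] E →L[ℝ] ℝ => T d b) h4)

variable [FiniteDimensional ℝ E]

theorem form_christoffel (g : LorentzMetric E M) (x : M) (a b d : E) :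
    g.form x (g.christoffel x a b) d
      = (g.dCoord x a b d + g.dCoord x b a d - g.dCoord x d a b) / 2 :=
  LinearMap.congr_fun
    (((g.bilin x).toDual (g.bilin_nondegenerate x)).apply_symm_apply (g.christoffelFirst x a b)) d

theorem form_ext (g : LorentzMetric E M) (x : M) {v w : E}
    (h : ∀ d, g.form x v d = g.form x w d) : v = w :=
  ((g.bilin x).toDual (g.bilin_nondegenerate x)).injective (LinearMap.ext h)

theorem christoffel_symm (g : LorentzMetric E M) (x : M) (a b : E) :
    g.christoffel x a b = g.christoffel x b a := by
  refine form_ext g x fun d => ?_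
  rw [form_christoffel, form_christoffel, dCoord_symm g x d a b]
  ring

theorem christoffel_add_right (g : LorentzMetric E M) (x : M) (a b c : E) :
    g.christoffel x a (b + c) = g.christoffel x a b + g.christoffel x a c := by
  refine form_ext g x fun d => ?_
  simp only [form_christoffel, map_add, add_apply]
  ring

theorem christoffel_smul_right (g : LorentzMetric E M) (x : M) (r : ℝ) (a b : E) :
    g.christoffel x a (r • b) = r • g.christoffel x a b := by
  refine form_ext g x fun d => ?_
  simp only [form_christoffel, map_smul, smul_apply, smul_eq_mul]
  ring

/-- Metric compatibility of the Levi-Civita derivative, for a field of locally constant square. -/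
theorem form_covDeriv_self_eq_zero (g : LorentzMetric E M)
    {F : Type*} [NormedAddCommGroup F] [NormedSpace ℝ F]
    {N : Type*} [TopologicalSpace N] [ChartedSpace F N]
    (f : N → M) (Y : N → E) (p : N) (w : F) (k : ℝ)
    (hf : MDifferentiableAt 𝓘(ℝ, F) 𝓘(ℝ, E) f p)
    (hY : MDifferentiableAt 𝓘(ℝ, F) 𝓘(ℝ, E) (fun q => components (f p) (f q) (Y q)) p)
    (hk : ∀ᶠ q in 𝓝 p, g.form (f q) (Y q) (Y q) = k) :
    g.form (f p) (g.covDeriv f Y p w) (Y p) = 0 := by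
  set y : N → E := fun q => components (f p) (f q) (Y q) with hy
  have hyp : y p = Y p := components_self _ _
  -- In the chart at `f p`, `g(Y, Y)` is `K` of the metric components and the field components; its
  -- derivative vanishes since it is locally constant.
  let K : (E →L[ℝ] E →L[ℝ] ℝ) × E → ℝ := fun z => z.1 z.2 z.2
  have hK : DifferentiableAt ℝ K (g.form (f p), Y p) := by
    unfold K; fun_prop
  have hK' : ∀ (B : E →L[ℝ] E →L[ℝ] ℝ) (v : E), fderiv ℝ K (g.form (f p), Y p) (B, v)
      = B (Y p) (Y p) + g.form (f p) v (Y p) + g.form (f p) (Y p) v := by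
    intro B v
    have h1 : HasFDerivAt (fun z : (E →L[ℝ] E →L[ℝ] ℝ) × E => z.1 z.2 z.2) _
      (g.form (f p), Y p) := (hasFDerivAt_fst.clm_apply hasFDerivAt_snd).clm_apply hasFDerivAt_snd
    rw [h1.fderiv]
    simp
    ring
  have hc : HasMFDerivAt 𝓘(ℝ, F) 𝓘(ℝ, E →L[ℝ] E →L[ℝ] ℝ) (fun q => g.coord (f p) (f q)) p
      ((g.dCoord (f p)).comp (mfderiv 𝓘(ℝ, F) 𝓘(ℝ, E) f p : F →L[ℝ] E)) :=
    (hasMFDerivAt_coord g (f p)).comp p hf.hasMFDerivAt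
  have hk' : (fun q => K (g.coord (f p) (f q), y q)) =ᶠ[𝓝 p] fun _ => k := by
    filter_upwards [hk, hf.continuousAt.preimage_mem_nhds
      ((chartAt E (f p)).open_source.mem_nhds (mem_chart_source E (f p)))] with q hq hq'
    rw [← hq]
    exact coord_components g hq' _ _
  have hp : (g.coord (f p) (f p), y p) = (g.form (f p), Y p) := by rw [coord_self, hyp]
  have hz := hasMFDerivAt_comp_prodMk (p := p) (hp ▸ hK.hasFDerivAt) hc hY.hasMFDerivAt
  have hz' := hasMFDerivAt_unique (hz.congr_of_eventuallyEq hk'.symm)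
    (hasMFDerivAt_const (I := 𝓘(ℝ, F)) (I' := 𝓘(ℝ, ℝ)) k p)
  let dy : E := mfderiv 𝓘(ℝ, F) 𝓘(ℝ, E) y p w
  let df : E := mfderiv 𝓘(ℝ, F) 𝓘(ℝ, E) f p w
  have h0 : fderiv ℝ K (g.coord (f p) (f p), y p) (g.dCoord (f p) df, dy) = 0 :=
    congrArg (fun T : F →L[ℝ] ℝ => T w) hz'
  rw [hp, hK'] at h0
  have h1 : g.covDeriv f Y p w = dy + g.christoffel (f p) df (Y p) := rfl
  have hs : g.form (f p) (Y p) dy = g.form (f p) dy (Y p) := (g.lorentz (f p)).1 _ _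
  -- With `b = d = Y` two Christoffel terms cancel, so `g(Γ(df, Y), Y)` is half the derivative of
  -- the metric components on `(Y, Y)`. Twice the goal is therefore the derivative in `h0`.
  rw [h1, map_add, add_apply, form_christoffel]
  linarith

end Coordinates

/-! ### The second fundamental form and the Gauss formula -/

section SecondFundamentalForm

variable {E : Type*} [NormedAddCommGroup E] [NormedSpace ℝ E]
  {M : Type*} [TopologicalSpace M] [ChartedSpace E M] [IsManifold 𝓘(ℝ, E) ∞ M]
  {S : Type*} [TopologicalSpace S] [ChartedSpace Plane S] [IsManifold 𝓘(ℝ, Plane) ∞ S]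

variable (E) in
/-- The expression of `i` in the preferred charts at `p` and `i p`. -/
def chartExpr (i : S → M) (p : S) : Plane → E :=
  writtenInExtChartAt 𝓘(ℝ, Plane) 𝓘(ℝ, E) p i

theorem two_le_infty : (2 : WithTop ℕ∞) ≤ ∞ :=
  WithTop.coe_le_coe.2 le_top

theorem contDiffAt_chartExpr {i : S → M} {p : S} (hi : ContMDiff 𝓘(ℝ, Plane) 𝓘(ℝ, E) ∞ i) :
    ContDiffAt ℝ ∞ (chartExpr E i p) (extChartAt 𝓘(ℝ, Plane) p p) := by
  have h := (contMDiffAt_iff.1 (hi p)).2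
  simpa [chartExpr, writtenInExtChartAt, contDiffWithinAt_univ] using h

variable (E) in
/-- The derivative of `i` at `p` as a linear map between the model spaces. -/
def pushL (i : S → M) (p : S) : Plane →L[ℝ] E := mfderiv 𝓘(ℝ, Plane) 𝓘(ℝ, E) i p

/-- Both sides are the derivative at `q` of one map, the chart at `i p` composed with `i`. A whole
neighbourhood is needed because pushed fields are differentiated. -/
theorem eventually_components_push {i : S → M} (hi : ContMDiff 𝓘(ℝ, Plane) 𝓘(ℝ, E) ∞ i)
    (p : S) : ∀ᶠ q in 𝓝 p, ∀ v : Plane, components (i p) (i q) (pushL E i q v)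
      = fderiv ℝ (chartExpr E i p) (extChartAt 𝓘(ℝ, Plane) p q) (components p q v) := by
  have : IsManifold 𝓘(ℝ, E) 1 M := .of_le (n := ∞) (by simp)
  have : IsManifold 𝓘(ℝ, Plane) 1 S := .of_le (n := ∞) (by simp)
  have hd : ∀ᶠ z in 𝓝 (extChartAt 𝓘(ℝ, Plane) p p), DifferentiableAt ℝ (chartExpr E i p) z :=
    (((contDiffAt_chartExpr hi).of_le (m := 1) (by simp)).eventually (by simp)).mono
      fun z hz => hz.differentiableAt (by simp)
  have hS := (chartAt Plane p).open_source.mem_nhds (mem_chart_source Plane p)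
  have hM := (hi.continuous.tendsto p).eventually
    ((chartAt E (i p)).open_source.eventually_mem (mem_chart_source E (i p)))
  filter_upwards [(continuousAt_extChartAt (I := 𝓘(ℝ, Plane)) p).eventually hd, hS, hM]
    with q hq hqS hqM v
  have hiq : MDifferentiableAt 𝓘(ℝ, Plane) 𝓘(ℝ, E) i q := (hi q).mdifferentiableAt (by simp)
  have h1 := (mdifferentiableAt_extChartAt (I := 𝓘(ℝ, E)) hqM).hasMFDerivAt.comp q
    hiq.hasMFDerivAt
  have h2 := hq.hasFDerivAt.hasMFDerivAt.comp q
    (mdifferentiableAt_extChartAt (I := 𝓘(ℝ, Plane)) hqS).hasMFDerivAt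
  have h3 : chartExpr E i p ∘ extChartAt 𝓘(ℝ, Plane) p
      =ᶠ[𝓝 q] extChartAt 𝓘(ℝ, E) (i p) ∘ i := by
    filter_upwards [(chartAt Plane p).open_source.mem_nhds hqS] with z hz
    simp only [chartExpr, writtenInExtChartAt, Function.comp]
    rw [(extChartAt 𝓘(ℝ, Plane) p).left_inv (by simpa using hz)]
  have h4 := hasMFDerivAt_unique (h1.congr_of_eventuallyEq h3) h2
  rw [components_eq_mfderiv hqM, components_eq_mfderiv hqS]
  exact congrArg (fun T : Plane →L[ℝ] E => T v) h4

theorem push_eq_fderiv {i : S → M} (hi : ContMDiff 𝓘(ℝ, Plane) 𝓘(ℝ, E) ∞ i) (p : S) (v : Plane) :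
    pushL E i p v = fderiv ℝ (chartExpr E i p) (extChartAt 𝓘(ℝ, Plane) p p) v := by
  have h := (eventually_components_push hi p).self_of_nhds v
  rwa [components_self, components_self] at h

variable [FiniteDimensional ℝ E]

/-- The second derivative of `i` at `p`, corrected by the Christoffel symbols of `M`. Modulo
vectors tangent to the surface it is the second fundamental form. -/
def ambientHessian (g : LorentzMetric E M) (i : S → M) (p : S) (a b : Plane) : E :=
  fderiv ℝ (fderiv ℝ (chartExpr E i p)) (extChartAt 𝓘(ℝ, Plane) p p) a b
    + g.christoffel (i p) (pushL E i p a) (pushL E i p b)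

/-- Second derivatives commute and the connection is torsion-free. This is why `∇_n τ` and `∇_τ n`
agree modulo tangent vectors. -/
theorem ambientHessian_symm (g : LorentzMetric E M) {i : S → M}
    (hi : ContMDiff 𝓘(ℝ, Plane) 𝓘(ℝ, E) ∞ i) (p : S) (a b : Plane) :
    ambientHessian g i p a b = ambientHessian g i p b a := by
  have h : IsSymmSndFDerivAt ℝ (chartExpr E i p) (extChartAt 𝓘(ℝ, Plane) p p) :=
    (contDiffAt_chartExpr hi).isSymmSndFDerivAt (by simpa using two_le_infty)
  rw [ambientHessian, ambientHessian, h.eq a b, christoffel_symm]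

theorem ambientHessian_add_right (g : LorentzMetric E M) (i : S → M) (p : S) (a b c : Plane) :
    ambientHessian g i p a (b + c) = ambientHessian g i p a b + ambientHessian g i p a c := by
  simp only [ambientHessian, map_add, christoffel_add_right]
  abel

theorem ambientHessian_smul_right (g : LorentzMetric E M) (i : S → M) (p : S) (r : ℝ)
    (a b : Plane) : ambientHessian g i p a (r • b) = r • ambientHessian g i p a b := by
  simp only [ambientHessian, map_smul, christoffel_smul_right, smul_add]

/-- Product rule for `D F(z) w`, where `F` is the chart expression of `i`. -/
theorem hasMFDerivAt_components_push {i : S → M} (hi : ContMDiff 𝓘(ℝ, Plane) 𝓘(ℝ, E) ∞ i)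
    {w : S → Plane} {p : S}
    (hw : MDifferentiableAt 𝓘(ℝ, Plane) 𝓘(ℝ, Plane) (fun q => components p q (w q)) p) :
    MDifferentiableAt 𝓘(ℝ, Plane) 𝓘(ℝ, E)
      (fun q => components (i p) (i q) (pushL E i q (w q))) p ∧
    ∀ a : Plane, (mfderiv 𝓘(ℝ, Plane) 𝓘(ℝ, E)
      (fun q => components (i p) (i q) (pushL E i q (w q))) p : Plane →L[ℝ] E) a =
      fderiv ℝ (fderiv ℝ (chartExpr E i p)) (extChartAt 𝓘(ℝ, Plane) p p) a (w p)
        + pushL E i p ((mfderiv 𝓘(ℝ, Plane) 𝓘(ℝ, Plane)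
          (fun q => components p q (w q)) p : Plane →L[ℝ] Plane) a) := by
  have : IsManifold 𝓘(ℝ, Plane) 1 S := .of_le (n := ∞) (by simp)
  have hD : DifferentiableAt ℝ (fderiv ℝ (chartExpr E i p)) (extChartAt 𝓘(ℝ, Plane) p p) :=
    ((contDiffAt_chartExpr hi).fderiv_right (m := 1) (by
      rw [one_add_one_eq_two]; exact two_le_infty)).differentiableAt (by simp)
  have hφ : HasMFDerivAt 𝓘(ℝ, Plane) 𝓘(ℝ, Plane) (extChartAt 𝓘(ℝ, Plane) p) p
      (ContinuousLinearMap.id ℝ Plane) := by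
    have h := (mdifferentiableAt_extChartAt (I := 𝓘(ℝ, Plane))
      (mem_chart_source Plane p)).hasMFDerivAt
    rwa [mfderiv_extChartAt_self] at h
  have hK : HasFDerivAt (fun z : Plane × Plane => fderiv ℝ (chartExpr E i p) z.1 z.2) _
      (extChartAt 𝓘(ℝ, Plane) p p, components p p (w p)) :=
    (HasFDerivAt.comp (extChartAt 𝓘(ℝ, Plane) p p, components p p (w p)) hD.hasFDerivAt
      hasFDerivAt_fst).clm_apply hasFDerivAt_snd
  have hz := hasMFDerivAt_comp_prodMk (p := p) hK hφ hw.hasMFDerivAt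
  have hz' := hz.congr_of_eventuallyEq
    ((eventually_components_push hi p).mono fun q hq => hq (w q))
  refine ⟨hz'.mdifferentiableAt, fun a => ?_⟩
  set dw : Plane := (mfderiv 𝓘(ℝ, Plane) 𝓘(ℝ, Plane)
    (fun q => components p q (w q)) p : Plane →L[ℝ] Plane) a
  refine (congrArg (fun T : Plane →L[ℝ] E => T a) hz'.mfderiv).trans ?_
  change fderiv ℝ (chartExpr E i p) (extChartAt 𝓘(ℝ, Plane) p p) dw
    + fderiv ℝ (fderiv ℝ (chartExpr E i p)) (extChartAt 𝓘(ℝ, Plane) p p) a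
      (components p p (w p)) = _
  rw [push_eq_fderiv hi, components_self, add_comm]

theorem mdifferentiableAt_components {U : Set S} (hU : IsOpen U)
    {w : S → Plane} (hw : IsVectorFieldOn U w) {p : S} (hp : p ∈ U) :
    MDifferentiableAt 𝓘(ℝ, Plane) 𝓘(ℝ, Plane) (fun q => components p q (w q)) p :=
  ((Bundle.contMDiffAt_section p).1 ((hw p hp).contMDiffAt (hU.mem_nhds hp))).mdifferentiableAt
    (by simp)

/-- `∇_m w`, with values in the model space. -/
def nablaL (g : LorentzMetric E M) (i : S → M) (m w : S → Plane) (p : S) : E := g.nabla i m w p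

/-- The Gauss formula modulo tangent vectors: derivatives of the components of `w` contribute only
the tangent vector `a`, which never needs to be identified. -/
theorem nabla_eq (g : LorentzMetric E M) {i : S → M} (hi : ContMDiff 𝓘(ℝ, Plane) 𝓘(ℝ, E) ∞ i)
    {U : Set S} (hU : IsOpen U) {w : S → Plane}
    (hw : IsVectorFieldOn U w) {p : S} (hp : p ∈ U) (m : S → Plane) :
    ∃ a : Plane, nablaL g i m w p = ambientHessian g i p (m p) (w p) + pushL E i p a := by
  have h := (hasMFDerivAt_components_push hi (mdifferentiableAt_components hU hw hp)).2 (m p)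
  refine ⟨(mfderiv 𝓘(ℝ, Plane) 𝓘(ℝ, Plane)
    (fun q => components p q (w q)) p : Plane →L[ℝ] Plane) (m p),
    (congrArg (fun e : E => e + g.christoffel (i p) (pushL E i p (m p)) (pushL E i p (w p)))
    h).trans ?_⟩
  simp only [ambientHessian]
  abel

theorem form_nabla_self_eq_zero (g : LorentzMetric E M) {i : S → M}
    (hi : ContMDiff 𝓘(ℝ, Plane) 𝓘(ℝ, E) ∞ i)
    {U : Set S} (hU : IsOpen U) {w : S → Plane}
    (hw : IsVectorFieldOn U w) {k : ℝ} (hk : ∀ q ∈ U, g.induced i q (w q) (w q) = k)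
    {p : S} (hp : p ∈ U) (m : S → Plane) :
    g.form (i p) (nablaL g i m w p) (pushL E i p (w p)) = 0 :=
  form_covDeriv_self_eq_zero g i (fun q => pushL E i q (w q)) p (m p) k
    ((hi p).mdifferentiableAt (by simp))
    (hasMFDerivAt_components_push hi (mdifferentiableAt_components hU hw hp)).1
    (by filter_upwards [hU.mem_nhds hp] with q hq using hk q hq)

/-- Along an integral curve `c` of `l`, the acceleration of `i ∘ c` is `∇_l l`. -/
theorem covDeriv_velocity_eq_nabla (g : LorentzMetric E M) {i : S → M}
    (hi : ContMDiff 𝓘(ℝ, Plane) 𝓘(ℝ, E) ∞ i)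
    {U : Set S} (hU : IsOpen U) {l : S → Plane}
    (hl : IsVectorFieldOn U l) {c : ℝ → S} {t : ℝ} (ht : c t ∈ U)
    (hc : IsMIntegralCurveAt (I := 𝓘(ℝ, Plane)) c l t) :
    velocity (F := E) (fun s => i (c s)) t = pushL E i (c t) (l (c t)) ∧
    g.covDeriv (F := ℝ) (fun s => i (c s)) (fun s => velocity (F := E) (fun s => i (c s)) s) t (1 : ℝ)
      = nablaL g i l l (c t) := by
  have hvel : ∀ᶠ s in 𝓝 t,
      velocity (F := E) (fun s => i (c s)) s = pushL E i (c s) (l (c s)) := by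
    filter_upwards [hc] with s hs
    have h := ((hi (c s)).mdifferentiableAt (by simp)).hasMFDerivAt.comp s hs
    have h' := h.mfderiv
    refine (congrArg (fun T : ℝ →L[ℝ] E => T 1) h').trans ?_
    exact congrArg (pushL E i (c s)) (one_smul ℝ (l _))
  have hv := hvel.self_of_nhds
  refine ⟨hv, ?_⟩
  have hy := (hasMFDerivAt_components_push hi (mdifferentiableAt_components hU hl ht)).1
  have h1 := hy.hasMFDerivAt.comp t hc.hasMFDerivAt
  have h2 := h1.congr_of_eventuallyEq (f₁ := fun s => components (i (c t)) (i (c s))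
    (velocity (F := E) (fun s => i (c s)) s)) (by
      filter_upwards [hvel] with s hs
      rw [hs]; rfl)
  have h3 : (mfderiv 𝓘(ℝ, ℝ) 𝓘(ℝ, E) (fun s => components (i (c t)) (i (c s))
      (velocity (F := E) (fun s => i (c s)) s)) t : ℝ →L[ℝ] E) 1
      = (mfderiv 𝓘(ℝ, Plane) 𝓘(ℝ, E) (fun q => components (i (c t)) (i q)
        (pushL E i q (l q))) (c t) : Plane →L[ℝ] E) (l (c t)) := by
    refine (congrArg (fun T : ℝ →L[ℝ] E => T 1) h2.mfderiv).trans ?_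
    exact congrArg (mfderiv 𝓘(ℝ, Plane) 𝓘(ℝ, E) (fun q => components (i (c t)) (i q)
        (pushL E i q (l q))) (c t) : Plane →L[ℝ] E) (one_smul ℝ (l _))
  exact congrArg₂ (fun a b : E => a + g.christoffel (i (c t)) b b) h3 hv

end SecondFundamentalForm

/-! ### Vector fields and smooth integral curves on the surface -/

section VectorFields

variable {S : Type*} [TopologicalSpace S] [ChartedSpace Plane S] [IsManifold 𝓘(ℝ, Plane) ∞ S]

theorem IsVectorFieldOn.add {U : Set S} {m w : S → Plane} (hm : IsVectorFieldOn U m)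
    (hw : IsVectorFieldOn U w) : IsVectorFieldOn U (fun q => (m q + w q : Plane)) :=
  ContMDiffOn.add_section hm hw

theorem IsVectorFieldOn.smul {U : Set S} {f : S → ℝ} {w : S → Plane}
    (hf : ContMDiffOn 𝓘(ℝ, Plane) 𝓘(ℝ, ℝ) ∞ f U) (hw : IsVectorFieldOn U w) :
    IsVectorFieldOn U (fun q => (f q • w q : Plane)) :=
  ContMDiffOn.smul_section hf hw

theorem IsVectorFieldOn.const_smul {U : Set S} (r : ℝ) {w : S → Plane} (hw : IsVectorFieldOn U w) :
    IsVectorFieldOn U (fun q => (r • w q : Plane)) :=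
  IsVectorFieldOn.smul contMDiffOn_const hw

theorem exists_isVectorFieldOn (p : S) (v : Plane) :
    ∃ (U : Set S) (w : S → Plane), IsOpen U ∧ p ∈ U ∧ IsVectorFieldOn U w ∧ w p = v := by
  obtain ⟨s, hs, h⟩ := FiberBundle.exists_contMDiffOn_extend (k := ∞) 𝓘(ℝ, Plane) Plane
    (V := (TangentSpace 𝓘(ℝ, Plane) : S → Type _)) (x₀ := p) v
  obtain ⟨U, hUs, hU, hp⟩ := mem_nhds_iff.1 hs
  exact ⟨U, _, hU, hp, h.mono hUs, FiberBundle.extend_apply_self ..⟩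

/-- A solution of an autonomous smooth ordinary differential equation is smooth. -/
theorem contDiffOn_of_hasDerivAt {F : Type*} [NormedAddCommGroup F] [NormedSpace ℝ F]
    {X : F → F} {O : Set F} (hX : ContDiffOn ℝ ∞ X O) {z : ℝ → F} {J : Set ℝ} (hJ : IsOpen J)
    (hz : ∀ t ∈ J, HasDerivAt z (X (z t)) t) (hzO : MapsTo z J O) : ContDiffOn ℝ ∞ z J := by
  have hd : DifferentiableOn ℝ z J := fun t ht => (hz t ht).differentiableAt.differentiableWithinAt
  rw [contDiffOn_infty]
  intro n
  induction n with
  | zero => exact contDiffOn_zero.2 hd.continuousOn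
  | succ n ih =>
    have h := contDiffOn_succ_iff_deriv_of_isOpen (n := n) (f := z) hJ
    refine h.2 ⟨hd, by simp, ?_⟩
    -- Bootstrapping: `z' = X ∘ z` is as regular as `z`, so `z` gains one derivative.
    exact ((hX.of_le (by exact_mod_cast le_top)).comp ih hzO).congr fun t ht => (hz t ht).deriv

/-- Integral curves of a smooth vector field exist and are smooth. -/
theorem exists_smooth_integralCurve {U : Set S} (hU : IsOpen U) {X : S → Plane}
    (hX : IsVectorFieldOn U X) {p : S} (hp : p ∈ U) :
    ∃ (ε : ℝ) (c : ℝ → S), 0 < ε ∧ c 0 = p ∧ MapsTo c (Metric.ball 0 ε) U ∧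
      ContMDiffOn 𝓘(ℝ, ℝ) 𝓘(ℝ, Plane) ∞ c (Metric.ball 0 ε) ∧
      ∀ t ∈ Metric.ball 0 ε, IsMIntegralCurveAt (I := 𝓘(ℝ, Plane)) c X t := by
  have : IsManifold 𝓘(ℝ, Plane) 1 S := .of_le (n := ∞) (by simp)
  obtain ⟨c, rfl, hc⟩ := exists_isMIntegralCurveAt_of_contMDiffAt_boundaryless 0
    (((hX p hp).contMDiffAt (hU.mem_nhds hp)).of_le (m := 1) (by simp))
  have hs : ∀ᶠ t in 𝓝 (0 : ℝ), c t ∈ U ∩ (chartAt Plane (c 0)).source :=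
    hc.continuousAt.eventually ((hU.inter (chartAt Plane (c 0)).open_source).mem_nhds
      ⟨hp, mem_chart_source _ _⟩)
  -- One ball on which the chart form of the equation holds, the curve stays in `U` and in the
  -- chart, and the curve is integral near every time.
  obtain ⟨ε, hε, hball⟩ := Metric.eventually_nhds_iff_ball.1
    (((hc.eventually_hasDerivAt).and hs).and (eventually_eventually_nhds.2 hc))
  refine ⟨ε, c, hε, rfl, fun t ht => (hball t ht).1.2.1, ?_, fun t ht => (hball t ht).2⟩
  set φ := extChartAt 𝓘(ℝ, Plane) (c 0) with hφ
  have hφs : φ.source = (chartAt Plane (c 0)).source := extChartAt_source _ _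
  set O : Set Plane := φ.target ∩ φ.symm ⁻¹' U
  have hW : ContDiffOn ℝ ∞ (fun x => components (c 0) (φ.symm x) (X (φ.symm x))) O := by
    rw [← contMDiffOn_iff_contDiffOn]
    have h1 : ContMDiffOn 𝓘(ℝ, Plane) 𝓘(ℝ, Plane) ∞ (fun q => components (c 0) q (X q))
        (U ∩ (chartAt Plane (c 0)).source) :=
      (Bundle.Trivialization.contMDiffOn_section_iff
        (trivializationAt Plane (TangentSpace 𝓘(ℝ, Plane) : S → Type _) (c 0))
        (hU.inter (chartAt Plane (c 0)).open_source) (by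
          rw [TangentBundle.trivializationAt_baseSet]; exact inter_subset_right)).1
        (hX.mono inter_subset_left)
    refine h1.comp ((contMDiffOn_extChartAt_symm (n := ∞) (c 0)).mono inter_subset_left) ?_
    rintro x ⟨hx, hx'⟩
    exact ⟨hx', hφs ▸ φ.map_target hx⟩
  have hz : ContDiffOn ℝ ∞ (φ ∘ c) (Metric.ball 0 ε) := by
    refine contDiffOn_of_hasDerivAt hW Metric.isOpen_ball (fun t ht => ?_) fun t ht => ?_
    · obtain ⟨⟨h1, h2, h3⟩, -⟩ := hball t ht
      have hl : φ.symm ((φ ∘ c) t) = c t := φ.left_inv (hφs ▸ h3)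
      rw [hl]
      refine h1.congr_deriv ?_
      rw [components_eq_mfderiv h3]
      exact congrArg (fun T : Plane →L[ℝ] Plane => T (X (c t)))
        (mfderiv_chartAt_eq_tangentCoordChange (I := 𝓘(ℝ, Plane)) h3).symm
    · obtain ⟨⟨h1, h2, h3⟩, -⟩ := hball t ht
      have hl : φ.symm ((φ ∘ c) t) = c t := φ.left_inv (hφs ▸ h3)
      exact ⟨φ.map_source (hφs ▸ h3), by rw [mem_preimage, hl]; exact h2⟩
  refine (((contMDiffOn_extChartAt_symm (I := 𝓘(ℝ, Plane)) (n := ∞) (c 0)).comp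
    hz.contMDiffOn ?_)).congr ?_
  · intro t ht
    exact φ.map_source (hφs ▸ (hball t ht).1.2.2)
  · intro t ht
    exact (φ.left_inv (hφs ▸ (hball t ht).1.2.2)).symm

end VectorFields

/-! ### The induced metric -/

section LocalFrame

variable {E : Type*} [NormedAddCommGroup E] [NormedSpace ℝ E]
  {M : Type*} [TopologicalSpace M] [ChartedSpace E M] [IsManifold 𝓘(ℝ, E) ∞ M]
  {S : Type*} [TopologicalSpace S] [ChartedSpace Plane S] [IsManifold 𝓘(ℝ, Plane) ∞ S]

/-- The induced metric as a bilinear form on the model plane. -/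
def inducedL (g : LorentzMetric E M) (i : S → M) (p : S) : Plane →L[ℝ] Plane →L[ℝ] ℝ :=
  (g.form (i p)).bilinearComp (pushL E i p) (pushL E i p)

theorem inducedL_symm (g : LorentzMetric E M) (i : S → M) (p : S) (v w : Plane) :
    inducedL g i p v w = inducedL g i p w v := (g.lorentz (i p)).1 _ _

theorem contMDiffOn_induced (g : LorentzMetric E M) {i : S → M}
    (hi : ContMDiff 𝓘(ℝ, Plane) 𝓘(ℝ, E) ∞ i) {U : Set S} {m w : S → Plane}
    (hm : IsVectorFieldOn U m) (hw : IsVectorFieldOn U w) :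
    ContMDiffOn 𝓘(ℝ, Plane) 𝓘(ℝ, ℝ) ∞ (fun q => inducedL g i q (m q) (w q)) U := by
  have hpush : ∀ {m : S → Plane}, IsVectorFieldOn U m →
      ContMDiffOn 𝓘(ℝ, Plane) 𝓘(ℝ, E).tangent ∞
        (fun q => (⟨i q, pushL E i q (m q)⟩ : TangentBundle 𝓘(ℝ, E) M)) U := fun hm =>
    (hi.contMDiff_tangentMap (m := ∞) (by simp)).comp_contMDiffOn hm
  have h := ContMDiffOn.clm_bundle_apply₂ (F₃ := ℝ) (E₃ := fun _ : M => ℝ)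
    (g.contMDiff.comp_contMDiffOn hi.contMDiffOn) (hpush hm) (hpush hw)
  intro q hq
  have := (Bundle.contMDiffWithinAt_totalSpace.1 (h q hq)).2
  exact this

end LocalFrame

/-! ### Local orthonormal frames -/

section OrthonormalPairs

variable {E : Type*} [NormedAddCommGroup E] [NormedSpace ℝ E] [FiniteDimensional ℝ E]
  {M : Type*} [TopologicalSpace M] [ChartedSpace E M] [IsManifold 𝓘(ℝ, E) ∞ M]
  {S : Type*} [TopologicalSpace S] [ChartedSpace Plane S] [IsManifold 𝓘(ℝ, Plane) ∞ S]

theorem IsTimelikeSurface.contMDiff {g : LorentzMetric E M} {i : S → M}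
    (hi : IsTimelikeSurface g i) : ContMDiff 𝓘(ℝ, Plane) 𝓘(ℝ, E) ∞ i :=
  hi.immersion.contMDiff

/-- A kernel vector would be orthogonal to everything, in particular to a timelike vector and to
itself, contradicting positivity on the timelike vector's complement. -/
theorem IsTimelikeSurface.pushL_ne_zero {g : LorentzMetric E M} {i : S → M}
    (hi : IsTimelikeSurface g i) (p : S) {v : Plane} (hv : v ≠ 0) : pushL E i p v ≠ 0 := by
  obtain ⟨-, t, ht, hpos⟩ := hi.timelike p
  intro h0
  have h1 : ∀ w : Plane, inducedL g i p w v = 0 := fun w => by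
    change g.form (i p) (pushL E i p w) (pushL E i p v) = 0
    rw [h0, map_zero]
  exact (hpos v hv (h1 t)).ne' (h1 v)

theorem exists_combination {a b : Plane} (h : LinearIndependent ℝ ![a, b]) (v : Plane) :
    ∃ x y : ℝ, v = x • a + y • b := by
  have hs := h.span_eq_top_of_card_eq_finrank (by simp)
  have hv : v ∈ Submodule.span ℝ (Set.range ![a, b]) := hs ▸ Submodule.mem_top
  rw [Matrix.range_cons, Matrix.range_cons, Matrix.range_empty, union_empty,
    singleton_union, Submodule.mem_span_pair] at hv
  obtain ⟨x, y, h⟩ := hv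
  exact ⟨x, y, h.symm⟩

/-- Rescaling a vector to square `σ = ±1`. -/
theorem bilin_normalize (B : Plane →L[ℝ] Plane →L[ℝ] ℝ) {σ : ℝ} (hσ : σ * σ = 1) {x : Plane}
    (h : 0 < σ * B x x) : B ((√(σ * B x x))⁻¹ • x) ((√(σ * B x x))⁻¹ • x) = σ := by
  have h1 : √(σ * B x x) * √(σ * B x x) = σ * B x x := Real.mul_self_sqrt h.le
  have h2 : √(σ * B x x) ≠ 0 := (Real.sqrt_pos.2 h).ne'
  simp only [map_smul, smul_apply, smul_eq_mul]
  field_simp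
  rw [pow_two, h1, ← mul_assoc, hσ, one_mul]

theorem isVectorFieldOn_normalize {U : Set S} {f : S → ℝ} {w : S → Plane}
    (hf : ContMDiffOn 𝓘(ℝ, Plane) 𝓘(ℝ, ℝ) ∞ f U) (hpos : ∀ q ∈ U, 0 < f q)
    (hw : IsVectorFieldOn U w) : IsVectorFieldOn U (fun q => ((√(f q))⁻¹ • w q : Plane)) := by
  refine IsVectorFieldOn.smul ?_ hw
  have h : ContDiffOn ℝ ∞ (fun x : ℝ => (√x)⁻¹) (Ioi 0) := fun x hx =>
    ((Real.contDiffAt_sqrt (ne_of_gt hx)).inv (Real.sqrt_pos.2 hx).ne').contDiffWithinAt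
  exact h.contMDiffOn.comp hf hpos

theorem isOrthonormalPair_iff {g : LorentzMetric E M} {i : S → M} {U : Set S} {n τ : S → Plane} :
    IsOrthonormalPair g i U n τ ↔ IsVectorFieldOn U n ∧ IsVectorFieldOn U τ ∧
      ∀ p ∈ U, inducedL g i p (n p) (n p) = -1 ∧ inducedL g i p (τ p) (τ p) = 1 ∧
        inducedL g i p (n p) (τ p) = 0 :=
  ⟨fun h => ⟨h.1.1, h.2.1, fun p hp => ⟨h.1.2 p hp, h.2.2 p hp⟩⟩,
    fun h => ⟨⟨h.1, fun p hp => (h.2.2 p hp).1⟩, h.2.1, fun p hp => (h.2.2 p hp).2⟩⟩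

/-- Every point of a timelike surface has a neighbourhood with an orthonormal pair. -/
theorem IsTimelikeSurface.exists_isOrthonormalPair {g : LorentzMetric E M} {i : S → M}
    (hi : IsTimelikeSurface g i) (p : S) :
    ∃ (U : Set S) (n τ : S → Plane), IsOpen U ∧ p ∈ U ∧ IsOrthonormalPair g i U n τ := by
  obtain ⟨-, v, hv, hpos⟩ := hi.timelike p
  have hv : inducedL g i p v v < 0 := hv
  have hpos : ∀ w : Plane, w ≠ 0 → inducedL g i p v w = 0 → 0 < inducedL g i p w w := hpos
  -- A functional on a plane has a nontrivial kernel.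
  obtain ⟨w, hw, hw0⟩ : ∃ w : Plane, inducedL g i p v w = 0 ∧ w ≠ 0 := by
    have := LinearMap.ker_ne_bot_of_finrank_lt (f := (inducedL g i p v : Plane →ₗ[ℝ] ℝ)) (by simp)
    obtain ⟨w, hw, hw0⟩ := Submodule.exists_mem_ne_zero_of_ne_bot this
    exact ⟨w, hw, hw0⟩
  obtain ⟨U₁, N, hU₁, hp₁, hN, hNp⟩ := exists_isVectorFieldOn p v
  obtain ⟨U₂, W, hU₂, hp₂, hW, hWp⟩ := exists_isVectorFieldOn p w
  have hU := hU₁.inter hU₂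
  replace hN : IsVectorFieldOn (U₁ ∩ U₂) N := hN.mono inter_subset_left
  replace hW : IsVectorFieldOn (U₁ ∩ U₂) W := hW.mono inter_subset_right
  have hf : ContMDiffOn 𝓘(ℝ, Plane) 𝓘(ℝ, ℝ) ∞ (fun q => -1 * inducedL g i q (N q) (N q))
      (U₁ ∩ U₂) := contMDiffOn_const.mul (contMDiffOn_induced g hi.contMDiff hN hN)
  have hU₃ := hf.continuousOn.isOpen_inter_preimage hU (isOpen_Ioi (a := 0))
  set U₃ := U₁ ∩ U₂ ∩ (fun q => -1 * inducedL g i q (N q) (N q)) ⁻¹' Ioi 0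
  have hp₃ : p ∈ U₃ := ⟨⟨hp₁, hp₂⟩, by simpa [hNp] using hv⟩
  set n : S → Plane := fun q => (√(-1 * inducedL g i q (N q) (N q)))⁻¹ • N q with hn
  have hnn : ∀ q ∈ U₃, inducedL g i q (n q) (n q) = -1 := fun q hq =>
    bilin_normalize _ (by norm_num) hq.2
  have hnv : IsVectorFieldOn U₃ n := isVectorFieldOn_normalize (hf.mono inter_subset_left)
    (fun q hq => hq.2) (hN.mono inter_subset_left)
  replace hW : IsVectorFieldOn U₃ W := hW.mono inter_subset_left
  -- Gram–Schmidt; the sign is plus because `g(n, n) = -1`. At `p` the correction vanishes, so `T p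
  -- = w` is spacelike, and it stays so nearby.
  set T : S → Plane := fun q => W q + inducedL g i q (n q) (W q) • n q with hT
  have hTv : IsVectorFieldOn U₃ T :=
    IsVectorFieldOn.add hW (.smul (contMDiffOn_induced g hi.contMDiff hnv hW) hnv)
  have hnT : ∀ q ∈ U₃, inducedL g i q (n q) (T q) = 0 := fun q hq => by
    simp only [hT, map_add, map_smul, smul_eq_mul, hnn q hq]; ring
  have hh : ContMDiffOn 𝓘(ℝ, Plane) 𝓘(ℝ, ℝ) ∞ (fun q => 1 * inducedL g i q (T q) (T q)) U₃ :=
    contMDiffOn_const.mul (contMDiffOn_induced g hi.contMDiff hTv hTv)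
  have hU₄ := hh.continuousOn.isOpen_inter_preimage hU₃ (isOpen_Ioi (a := 0))
  have hTp : T p = w := by
    simp only [hT, hn, hNp, hWp, map_smul, smul_apply, hw, smul_zero, zero_smul, add_zero]
  refine ⟨_, n, fun q => (√(1 * inducedL g i q (T q) (T q)))⁻¹ • T q, hU₄,
    ⟨hp₃, by simpa [hTp] using hpos w hw0 hw⟩, isOrthonormalPair_iff.2
      ⟨hnv.mono inter_subset_left, isVectorFieldOn_normalize (hh.mono inter_subset_left)
        (fun q hq => hq.2) (hTv.mono inter_subset_left), fun q hq => ⟨hnn q hq.1,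
          bilin_normalize _ (by norm_num) hq.2, ?_⟩⟩⟩
  simp only [map_smul, hnT q hq.1, smul_zero]

end OrthonormalPairs

/-! ### Vanishing of the second fundamental form on lightlike vectors -/

section PhotonPoints

variable {E : Type*} [NormedAddCommGroup E] [NormedSpace ℝ E] [FiniteDimensional ℝ E]
  {M : Type*} [TopologicalSpace M] [ChartedSpace E M] [IsManifold 𝓘(ℝ, E) ∞ M]
  {S : Type*} [TopologicalSpace S] [ChartedSpace Plane S] [IsManifold 𝓘(ℝ, Plane) ∞ S]

variable (E) in
/-- The image in the model space of the tangent plane of the surface at `p`. -/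
def tangentPlane (i : S → M) (p : S) : Submodule ℝ E :=
  LinearMap.range (pushL E i p : Plane →ₗ[ℝ] E)

/-- The second fundamental form of the surface at `p` vanishes on lightlike vectors. -/
def IsPhotonPoint (g : LorentzMetric E M) (i : S → M) (p : S) : Prop :=
  ∀ l : Plane, inducedL g i p l l = 0 → ambientHessian g i p l l ∈ tangentPlane E i p

theorem pushL_mem_tangentPlane (i : S → M) (p : S) (a : Plane) :
    pushL E i p a ∈ tangentPlane E i p := ⟨a, rfl⟩

theorem nablaL_mem_tangentPlane_iff (g : LorentzMetric E M) {i : S → M}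
    (hi : ContMDiff 𝓘(ℝ, Plane) 𝓘(ℝ, E) ∞ i) {U : Set S} (hU : IsOpen U) {w : S → Plane}
    (hw : IsVectorFieldOn U w) {p : S} (hp : p ∈ U) (m : S → Plane) :
    nablaL g i m w p ∈ tangentPlane E i p ↔
      ambientHessian g i p (m p) (w p) ∈ tangentPlane E i p := by
  obtain ⟨a, ha⟩ := nabla_eq g hi hU hw hp m
  rw [ha, Submodule.add_mem_iff_left _ (pushL_mem_tangentPlane i p a)]

theorem ambientHessian_combination (g : LorentzMetric E M) {i : S → M}
    (hi : ContMDiff 𝓘(ℝ, Plane) 𝓘(ℝ, E) ∞ i) (p : S) (a b : Plane) (x y z w : ℝ) :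
    ambientHessian g i p (x • a + y • b) (z • a + w • b)
      = (x * z) • ambientHessian g i p a a + (y * w) • ambientHessian g i p b b
        + (x * w + y * z) • ambientHessian g i p a b := by
  have h1 : ∀ c, ambientHessian g i p (x • a + y • b) c
      = x • ambientHessian g i p a c + y • ambientHessian g i p b c := fun c => by
    rw [ambientHessian_symm g hi, ambientHessian_add_right, ambientHessian_smul_right,
      ambientHessian_smul_right, ambientHessian_symm g hi p c a, ambientHessian_symm g hi p c b]
  rw [h1]
  simp only [ambientHessian_add_right, ambientHessian_smul_right]
  rw [ambientHessian_symm g hi p b a]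
  module

theorem inducedL_combination (g : LorentzMetric E M) (i : S → M) (p : S) (a b : Plane)
    (x y z w : ℝ) :
    inducedL g i p (x • a + y • b) (z • a + w • b)
      = (x * z) * inducedL g i p a a + (y * w) * inducedL g i p b b
        + (x * w + y * z) * inducedL g i p a b := by
  simp only [map_add, map_smul, add_apply, smul_apply, smul_eq_mul, inducedL_symm g i p b a]
  ring

/-- The vectors `n`, `τ` of the model plane are orthonormal at `p`. -/
def IsOrthonormalAt (g : LorentzMetric E M) (i : S → M) (p : S) (n τ : Plane) : Prop :=
  inducedL g i p n n = -1 ∧ inducedL g i p τ τ = 1 ∧ inducedL g i p n τ = 0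

theorem IsOrthonormalAt.linearIndependent {g : LorentzMetric E M} {i : S → M} {p : S}
    {n τ : Plane} (h : IsOrthonormalAt g i p n τ) : LinearIndependent ℝ ![n, τ] := by
  obtain ⟨h1, h2, h3⟩ := h
  rw [LinearIndependent.pair_iff]
  intro s t hst
  have e1 := inducedL_combination g i p n τ s t 1 0
  have e2 := inducedL_combination g i p n τ s t 0 1
  rw [hst, h1, h2, h3, map_zero, zero_apply] at e1 e2
  constructor <;> linarith

/-- Orthonormal expansion; the minus sign comes from `g(n, n) = -1`. -/
theorem IsOrthonormalAt.exists_eq {g : LorentzMetric E M} {i : S → M} {p : S}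
    {n τ : Plane} (h : IsOrthonormalAt g i p n τ) {e : E} (he : e ∈ tangentPlane E i p) :
    e = -g.form (i p) e (pushL E i p n) • pushL E i p n
      + g.form (i p) e (pushL E i p τ) • pushL E i p τ := by
  obtain ⟨v, rfl⟩ := he
  obtain ⟨x, y, rfl⟩ := exists_combination h.linearIndependent v
  obtain ⟨h1, h2, h3⟩ := h
  have e1 := inducedL_combination g i p n τ x y 1 0
  have e2 := inducedL_combination g i p n τ x y 0 1
  rw [h1, h2, h3] at e1 e2
  simp only [one_smul, zero_smul, zero_add, add_zero] at e1 e2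
  have e1' : g.form (i p) (pushL E i p (x • n + y • τ)) (pushL E i p n) = _ := e1
  have e2' : g.form (i p) (pushL E i p (x • n + y • τ)) (pushL E i p τ) = _ := e2
  change pushL E i p (x • n + y • τ) = -g.form (i p) (pushL E i p (x • n + y • τ)) (pushL E i p n)
    • _ + g.form (i p) (pushL E i p (x • n + y • τ)) (pushL E i p τ) • _
  rw [e1', e2', map_add, map_smul, map_smul]
  module

theorem IsOrthonormalAt.isPhotonPoint_iff {g : LorentzMetric E M} {i : S → M}
    (hi : ContMDiff 𝓘(ℝ, Plane) 𝓘(ℝ, E) ∞ i) {p : S}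
    {n τ : Plane} (h : IsOrthonormalAt g i p n τ) :
    IsPhotonPoint g i p ↔ ambientHessian g i p n τ ∈ tangentPlane E i p ∧
      ambientHessian g i p n n + ambientHessian g i p τ τ ∈ tangentPlane E i p := by
  constructor
  · intro hP
    obtain ⟨h1, h2, h3⟩ := h
    have a1 := hP ((1 : ℝ) • n + (1 : ℝ) • τ) (by
      rw [inducedL_combination, h1, h2, h3]; ring)
    have a2 := hP ((1 : ℝ) • n + (-1 : ℝ) • τ) (by
      rw [inducedL_combination, h1, h2, h3]; ring)
    rw [ambientHessian_combination g hi] at a1 a2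
    constructor
    -- The values on `n + τ` and `n - τ` differ by `4 II(n, τ)` and add up to `2 (II(n, n) + II(τ,
    -- τ))`.
    · convert Submodule.smul_mem _ (1 / 4 : ℝ) (sub_mem a1 a2) using 1
      module
    · convert Submodule.smul_mem _ (1 / 2 : ℝ) (add_mem a1 a2) using 1
      module
  · rintro ⟨hm, hs⟩ l hl
    obtain ⟨x, y, rfl⟩ := exists_combination h.linearIndependent l
    obtain ⟨h1, h2, h3⟩ := h
    rw [inducedL_combination, h1, h2, h3] at hl
    have hxy : y * y = x * x := by linarith
    rw [ambientHessian_combination g hi, hxy, ← smul_add]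
    exact add_mem (Submodule.smul_mem _ _ hs) (Submodule.smul_mem _ _ hm)

/-- If the second fundamental form vanishes on two independent lightlike vectors, it vanishes on
all lightlike vectors. -/
theorem IsTimelikeSurface.isPhotonPoint_of_lightlike {g : LorentzMetric E M} {i : S → M}
    (hi : IsTimelikeSurface g i) {p : S} {a b : Plane} (hab : LinearIndependent ℝ ![a, b])
    (ha : inducedL g i p a a = 0) (hb : inducedL g i p b b = 0)
    (ha' : ambientHessian g i p a a ∈ tangentPlane E i p)
    (hb' : ambientHessian g i p b b ∈ tangentPlane E i p) : IsPhotonPoint g i p := by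
  -- Otherwise the induced form would vanish identically, leaving no timelike vector. Hence a
  -- lightlike `x a + y b` has `x y = 0`, and the mixed term drops out.
  have hne : inducedL g i p a b ≠ 0 := by
    intro h0
    obtain ⟨-, v, hv, -⟩ := hi.timelike p
    have hv : inducedL g i p v v < 0 := hv
    obtain ⟨x, y, hxy⟩ := exists_combination hab v
    rw [hxy, inducedL_combination, ha, hb, h0] at hv
    linarith
  intro l hl
  obtain ⟨x, y, rfl⟩ := exists_combination hab l
  rw [inducedL_combination, ha, hb] at hl
  have hxy : x * y + y * x = 0 := by
    rcases mul_eq_zero.1 (show (x * y + y * x) * inducedL g i p a b = 0 by linarith) with h | h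
    · exact h
    · exact absurd h hne
  rw [ambientHessian_combination g hi.contMDiff, hxy, zero_smul, add_zero]
  exact add_mem (Submodule.smul_mem _ _ ha') (Submodule.smul_mem _ _ hb')

end PhotonPoints

/-! ### Each condition compared with the photon-point condition -/

section Equivalences

variable {E : Type*} [NormedAddCommGroup E] [NormedSpace ℝ E] [FiniteDimensional ℝ E]
  {M : Type*} [TopologicalSpace M] [ChartedSpace E M] [IsManifold 𝓘(ℝ, E) ∞ M]
  {S : Type*} [TopologicalSpace S] [ChartedSpace Plane S] [IsManifold 𝓘(ℝ, Plane) ∞ S]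
  {g : LorentzMetric E M} {i : S → M} {U : Set S} {n τ : S → Plane} {p : S}

theorem IsOrthonormalPair.isOrthonormalAt (h : IsOrthonormalPair g i U n τ) (hp : p ∈ U) :
    IsOrthonormalAt g i p (n p) (τ p) :=
  (isOrthonormalPair_iff.1 h).2.2 p hp

/-- A constant boost of the frame, with `x` and `y` as hyperbolic cosine and sine. -/
theorem IsOrthonormalPair.combination (h : IsOrthonormalPair g i U n τ) {x y : ℝ}
    (hxy : x ^ 2 - y ^ 2 = 1) :
    IsOrthonormalPair g i U (fun q => x • n q + y • τ q) (fun q => y • n q + x • τ q) := by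
  obtain ⟨hn, hτ, ho⟩ := isOrthonormalPair_iff.1 h
  refine isOrthonormalPair_iff.2 ⟨.add (.const_smul x hn) (.const_smul y hτ),
    .add (.const_smul y hn) (.const_smul x hτ), fun p hp => ?_⟩
  obtain ⟨h1, h2, h3⟩ := ho p hp
  refine ⟨?_, ?_, ?_⟩ <;> rw [inducedL_combination, h1, h2, h3] <;> linarith

/-- The bracket of the Coriolis acceleration, with values in the model space. -/
def coriolisBracket (g : LorentzMetric E M) (i : S → M) (n τ : S → Plane) (p : S) : E :=
  nablaL g i n τ p + nablaL g i τ n p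
    + g.form (i p) (nablaL g i n τ p) (pushL E i p (n p)) • pushL E i p (n p)
    - g.form (i p) (nablaL g i τ n p) (pushL E i p (τ p)) • pushL E i p (τ p)

/-- The bracket of the centrifugal acceleration, with values in the model space. -/
def centrifugalBracket (g : LorentzMetric E M) (i : S → M) (n τ : S → Plane) (p : S) : E :=
  nablaL g i τ τ p + nablaL g i n n p
    + g.form (i p) (nablaL g i τ τ p) (pushL E i p (n p)) • pushL E i p (n p)
    - g.form (i p) (nablaL g i n n p) (pushL E i p (τ p)) • pushL E i p (τ p)

theorem coriolis_eq (g : LorentzMetric E M) (i : S → M) (n τ : S → Plane) (p : S) (v : ℝ) :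
    g.coriolis i n τ p v = (-(lorentzFactor v ^ 2 * v) • coriolisBracket g i n τ p : E) := rfl

theorem centrifugal_eq (g : LorentzMetric E M) (i : S → M) (n τ : S → Plane) (p : S) (v : ℝ) :
    g.centrifugal i n τ p v
      = (-(lorentzFactor v ^ 2 * v ^ 2) • centrifugalBracket g i n τ p : E) := rfl

/-- Since `II(n, τ) = 0`, `∇_n τ` is tangent; since `g(τ, τ)` is constant, it has no `τ`-component.
-/
theorem nablaL_of_isPhotonPoint (hi : ContMDiff 𝓘(ℝ, Plane) 𝓘(ℝ, E) ∞ i) (hU : IsOpen U)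
    (h : IsOrthonormalPair g i U n τ) (hp : p ∈ U) (hP : IsPhotonPoint g i p) :
    nablaL g i n τ p
      = -g.form (i p) (nablaL g i n τ p) (pushL E i p (n p)) • pushL E i p (n p) := by
  have ho := h.isOrthonormalAt hp
  obtain ⟨-, hτ, hg⟩ := isOrthonormalPair_iff.1 h
  have h1 := (nablaL_mem_tangentPlane_iff g hi hU hτ hp n).2 ((ho.isPhotonPoint_iff hi).1 hP).1
  have h2 := ho.exists_eq h1
  rwa [form_nabla_self_eq_zero g hi hU hτ (fun q hq => (hg q hq).2.1) hp, zero_smul, add_zero]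
    at h2

theorem coriolisBracket_eq_zero (hi : ContMDiff 𝓘(ℝ, Plane) 𝓘(ℝ, E) ∞ i) (hU : IsOpen U)
    (h : IsOrthonormalPair g i U n τ) (hp : p ∈ U) (hP : IsPhotonPoint g i p) :
    coriolisBracket g i n τ p = 0 := by
  have ho := h.isOrthonormalAt hp
  have h0 := nablaL_of_isPhotonPoint hi hU h hp hP
  obtain ⟨hn, -, hg⟩ := isOrthonormalPair_iff.1 h
  have h1 := (nablaL_mem_tangentPlane_iff g hi hU hn hp τ).2
    (ambientHessian_symm g hi p (n p) (τ p) ▸ ((ho.isPhotonPoint_iff hi).1 hP).1)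
  have h2 := ho.exists_eq h1
  rw [form_nabla_self_eq_zero g hi hU hn (fun q hq => (hg q hq).1) hp, neg_zero, zero_smul,
    zero_add] at h2
  rw [coriolisBracket, sub_eq_zero, ← h2, add_right_comm, add_eq_right]
  nth_rw 1 [h0]
  rw [neg_smul, neg_add_cancel]

theorem centrifugalBracket_eq_zero (hi : ContMDiff 𝓘(ℝ, Plane) 𝓘(ℝ, E) ∞ i) (hU : IsOpen U)
    (h : IsOrthonormalPair g i U n τ) (hp : p ∈ U) (hP : IsPhotonPoint g i p) :
    centrifugalBracket g i n τ p = 0 := by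
  have ho := h.isOrthonormalAt hp
  obtain ⟨hn, hτ, hg⟩ := isOrthonormalPair_iff.1 h
  obtain ⟨a, ha⟩ := nabla_eq g hi hU hn hp n
  obtain ⟨b, hb⟩ := nabla_eq g hi hU hτ hp τ
  -- Only the sum is known to be tangent, so it is expanded as a whole; metric compatibility then
  -- removes one of the two terms from each coefficient.
  have h1 : nablaL g i τ τ p + nablaL g i n n p ∈ tangentPlane E i p := by
    rw [ha, hb]
    convert add_mem ((ho.isPhotonPoint_iff hi).1 hP).2 (pushL_mem_tangentPlane i p (a + b)) using 1
    rw [map_add]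
    abel
  have h2 := ho.exists_eq h1
  rw [map_add, add_apply, add_apply,
    form_nabla_self_eq_zero g hi hU hn (fun q hq => (hg q hq).1) hp,
    form_nabla_self_eq_zero g hi hU hτ (fun q hq => (hg q hq).2.1) hp, add_zero, zero_add] at h2
  rw [centrifugalBracket, h2]
  module

theorem isPhotonPoint_of_bracket_eq_zero (hi : ContMDiff 𝓘(ℝ, Plane) 𝓘(ℝ, E) ∞ i) (hU : IsOpen U)
    (h : IsOrthonormalPair g i U n τ) (hp : p ∈ U) (hcor : coriolisBracket g i n τ p = 0)
    (hcen : centrifugalBracket g i n τ p = 0) : IsPhotonPoint g i p := by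
  obtain ⟨hn, hτ, -⟩ := isOrthonormalPair_iff.1 h
  obtain ⟨a, ha⟩ := nabla_eq g hi hU hn hp n
  obtain ⟨b, hb⟩ := nabla_eq g hi hU hτ hp τ
  obtain ⟨c, hc⟩ := nabla_eq g hi hU hτ hp n
  obtain ⟨d, hd⟩ := nabla_eq g hi hU hn hp τ
  rw [ambientHessian_symm g hi] at hd
  refine ((h.isOrthonormalAt hp).isPhotonPoint_iff hi).2 ⟨?_, ?_⟩
  · generalize ambientHessian g i p (n p) (τ p) = B at hc hd ⊢
    rw [coriolisBracket] at hcor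
    generalize g.form (i p) (nablaL g i n τ p) (pushL E i p (n p)) = x at hcor
    generalize g.form (i p) (nablaL g i τ n p) (pushL E i p (τ p)) = y at hcor
    rw [hc, hd] at hcor
    have hB : B = (1 / 2 : ℝ) • pushL E i p (y • τ p - x • n p - c - d) + (1 / 2 : ℝ) • (0 : E) := by
      rw [← hcor]
      simp only [map_sub, map_smul]
      module
    rw [hB, smul_zero, add_zero]
    exact Submodule.smul_mem _ _ (pushL_mem_tangentPlane i p _)
  · rw [centrifugalBracket] at hcen
    generalize g.form (i p) (nablaL g i τ τ p) (pushL E i p (n p)) = x at hcen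
    generalize g.form (i p) (nablaL g i n n p) (pushL E i p (τ p)) = y at hcen
    rw [ha, hb] at hcen
    have hB : ambientHessian g i p (n p) (n p) + ambientHessian g i p (τ p) (τ p)
        = pushL E i p (y • τ p - x • n p - a - b) + 0 := by
      rw [← hcen]
      simp only [map_sub, map_smul]
      module
    rw [hB, add_zero]
    exact pushL_mem_tangentPlane i p _

theorem isGenerated_of_isPhotonPoint (hi : IsTimelikeSurface g i) (hU : IsOpen U)
    (h : IsOrthonormalPair g i U n τ) (hP : ∀ p ∈ U, IsPhotonPoint g i p) :
    IsGeneratedByLightlikeGeodesics g i U := by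
  obtain ⟨hn, hτ, hg⟩ := isOrthonormalPair_iff.1 h
  have key : ∀ σ : ℝ, σ * σ = 1 →
      IsLightlikeGeodesicCongruence g i U (fun q => ((1 : ℝ) • n q + σ • τ q : Plane)) := by
    intro σ hσ
    have hl : IsVectorFieldOn U (fun q => ((1 : ℝ) • n q + σ • τ q : Plane)) :=
      .add (.const_smul 1 hn) (.const_smul σ hτ)
    have hnull : ∀ q ∈ U, inducedL g i q ((1 : ℝ) • n q + σ • τ q) ((1 : ℝ) • n q + σ • τ q) = 0 := by
      intro q hq
      obtain ⟨h1, h2, h3⟩ := hg q hq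
      rw [inducedL_combination, h1, h2, h3, hσ]
      ring
    have hne : ∀ q ∈ U, (1 : ℝ) • n q + σ • τ q ≠ 0 := fun q hq h0 =>
      one_ne_zero (LinearIndependent.pair_iff.1 (h.isOrthonormalAt hq).linearIndependent 1 σ h0).1
    refine ⟨hl, fun q hq => ⟨hne q hq, hnull q hq⟩, fun J c hJ _ hcU hc t ht => ?_⟩
    have hcU := hcU ht
    obtain ⟨hv, ha⟩ := covDeriv_velocity_eq_nabla g hi.contMDiff hU hl hcU
      (hc.isMIntegralCurveAt (hJ.mem_nhds ht))
    have h1 := (h.isOrthonormalAt hcU).exists_eq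
      ((nablaL_mem_tangentPlane_iff g hi.contMDiff hU hl hcU
        (fun q => ((1 : ℝ) • n q + σ • τ q : Plane))).2 (hP _ hcU _ (hnull _ hcU)))
    have h2 := form_nabla_self_eq_zero g hi.contMDiff hU hl hnull hcU
      (fun q => ((1 : ℝ) • n q + σ • τ q : Plane))
    refine ⟨fun h0 => hi.pushL_ne_zero _ (hne _ hcU) (hv.symm.trans h0), ?_⟩
    generalize nablaL g i (fun q => ((1 : ℝ) • n q + σ • τ q : Plane))
      (fun q => ((1 : ℝ) • n q + σ • τ q : Plane)) (c t) = e at *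
    refine ⟨-g.form (i (c t)) e (pushL E i (c t) (n (c t))), ha.trans ?_⟩
    refine Eq.trans ?_ (congrArg (fun z : E => (-g.form (i (c t)) e (pushL E i (c t) (n (c t)))) • z)
      hv.symm)
    rw [map_add, map_smul, map_smul, map_add, map_smul, map_smul, smul_eq_mul, smul_eq_mul] at h2
    generalize g.form (i (c t)) e (pushL E i (c t) (n (c t))) = x at *
    generalize g.form (i (c t)) e (pushL E i (c t) (τ (c t))) = y at *
    -- Orthogonality to `n + σ τ` says `x + σ y = 0`, and `σ² = 1`. So the tangent vector `-x n + y
    -- τ` is `-x (n + σ τ)`.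
    have hy : y = -x * σ := by linear_combination -y * hσ + σ * h2
    rw [h1, hy, map_add, map_smul, map_smul]
    change -x • pushL E i (c t) (n (c t)) + (-x * σ) • pushL E i (c t) (τ (c t))
      = -x • ((1 : ℝ) • pushL E i (c t) (n (c t)) + σ • pushL E i (c t) (τ (c t)))
    module
  refine ⟨_, _, key 1 (by norm_num), key (-1) (by norm_num), fun p hp => ?_⟩
  have hli := (h.isOrthonormalAt hp).linearIndependent
  rw [LinearIndependent.pair_iff] at hli
  refine LinearIndependent.pair_iff.2 fun s t hst => ?_
  replace hst : s • ((1 : ℝ) • n p + (1 : ℝ) • τ p) + t • ((1 : ℝ) • n p + (-1 : ℝ) • τ p) = 0 := hst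
  have := hli (s + t) (s - t) (by rw [← hst]; module)
  constructor <;> linarith

/-- The geodesic equation on the integral curve through `p` makes `∇_l l` a multiple of `l`, hence
tangent, for both lightlike fields. -/
theorem isPhotonPoint_of_isGenerated (hi : IsTimelikeSurface g i) (hU : IsOpen U)
    (h : IsGeneratedByLightlikeGeodesics g i U) (hp : p ∈ U) : IsPhotonPoint g i p := by
  have key : ∀ l : S → Plane, IsLightlikeGeodesicCongruence g i U l →
      inducedL g i p (l p) (l p) = 0 ∧
        ambientHessian g i p (l p) (l p) ∈ tangentPlane E i p := by
    rintro l ⟨hl, hnull, hgeo⟩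
    refine ⟨(hnull p hp).2, ?_⟩
    obtain ⟨ε, c, hε, rfl, hcU, -, hc⟩ := exists_smooth_integralCurve hU hl hp
    have h0 := Metric.mem_ball_self (x := (0 : ℝ)) hε
    obtain ⟨hv, ha⟩ := covDeriv_velocity_eq_nabla g hi.contMDiff hU hl hp (hc 0 h0)
    obtain ⟨-, q, hq⟩ := hgeo (Metric.ball 0 ε) c Metric.isOpen_ball
      (by rw [Real.ball_eq_Ioo]; exact ordConnected_Ioo) hcU
      (fun t ht => (hc t ht).hasMFDerivAt.hasMFDerivWithinAt) 0 h0
    rw [← nablaL_mem_tangentPlane_iff g hi.contMDiff hU hl hp, ← ha]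
    refine ⟨q • l (c 0), (map_smul _ _ _).trans ?_⟩
    exact (congrArg (fun e : E => q • e) hv.symm).trans hq.symm
  obtain ⟨l₁, l₂, h₁, h₂, hli⟩ := h
  exact hi.isPhotonPoint_of_lightlike (hli p hp) (key l₁ h₁).1 (key l₂ h₂).1 (key l₁ h₁).2
    (key l₂ h₂).2

theorem fermiWalkerParallel_of_isPhotonPoint (hi : IsTimelikeSurface g i) (hU : IsOpen U)
    (hP : ∀ p ∈ U, IsPhotonPoint g i p) : FermiWalkerParallel g i U := by
  intro n τ h p hp
  have := nablaL_of_isPhotonPoint hi.contMDiff hU h hp (hP p hp)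
  exact ⟨_, this⟩

theorem isPhotonPoint_of_fermiWalkerParallel (hi : IsTimelikeSurface g i) (hU : IsOpen U)
    (h : IsOrthonormalPair g i U n τ) (hF : FermiWalkerParallel g i U) (hp : p ∈ U) :
    IsPhotonPoint g i p := by
  have key : ∀ n τ : S → Plane, IsOrthonormalPair g i U n τ →
      ambientHessian g i p (n p) (τ p) ∈ tangentPlane E i p := by
    intro n τ h
    rw [← nablaL_mem_tangentPlane_iff g hi.contMDiff hU (isOrthonormalPair_iff.1 h).2.1 hp]
    obtain ⟨r, hr⟩ := hF n τ h p hp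
    exact ⟨r • n p, (map_smul (pushL E i p) r (n p)).trans hr.symm⟩
  have h1 := key n τ h
  -- In the boosted frame the mixed term is `(15/16) (II(n, n) + II(τ, τ)) + (34/16) II(n, τ)`, so
  -- subtracting a multiple of `h1` isolates the sum.
  have h2 := key _ _ (h.combination (x := 5 / 4) (y := 3 / 4) (by norm_num))
  rw [ambientHessian_combination g hi.contMDiff] at h2
  refine ((h.isOrthonormalAt hp).isPhotonPoint_iff hi.contMDiff).2 ⟨h1, ?_⟩
  convert Submodule.smul_mem _ (16 / 15 : ℝ) (sub_mem h2 (Submodule.smul_mem _ (34 / 16 : ℝ) h1))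
    using 1
  module

theorem noCentrifugalCoriolis_of_isPhotonPoint (hi : IsTimelikeSurface g i)
    (hP : ∀ p ∈ U, IsPhotonPoint g i p) : NoCentrifugalCoriolis g i U := by
  intro n _ J c _ _ t _ V hV hVU hcV τ h v _
  have hp := hP _ (hVU hcV)
  constructor
  · refine (centrifugal_eq g i n τ (c t) v).trans ?_
    rw [centrifugalBracket_eq_zero hi.contMDiff hV h hcV hp]
    exact smul_zero (A := E) _
  · refine (coriolis_eq g i n τ (c t) v).trans ?_
    rw [coriolisBracket_eq_zero hi.contMDiff hV h hcV hp]
    exact smul_zero (A := E) _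

theorem lorentzFactor_three_fifths : lorentzFactor (3 / 5) = 5 / 4 := by
  have h : (1 - (3 / 5 : ℝ) ^ 2) = (4 / 5) ^ 2 := by norm_num
  rw [lorentzFactor, h, Real.sqrt_sq (by norm_num)]
  norm_num

/-- One worldline through `p` suffices, provided `v ≠ 0` so that the prefactors can be divided out.
An integral curve of the boosted observer field `γ (n + v τ)` serves, with `v = 3/5` and `γ = 5/4`
keeping the square root rational. -/
theorem isPhotonPoint_of_noCentrifugalCoriolis (hi : IsTimelikeSurface g i) (hU : IsOpen U)
    (h : IsOrthonormalPair g i U n τ) (hN : NoCentrifugalCoriolis g i U) (hp : p ∈ U) :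
    IsPhotonPoint g i p := by
  have hu := (h.combination (x := 5 / 4) (y := 3 / 4) (by norm_num)).1
  obtain ⟨ε, c, hε, rfl, hcU, hcs, hc⟩ := exists_smooth_integralCurve hU hu.1 hp
  have h0 := Metric.mem_ball_self (x := (0 : ℝ)) hε
  have hvel : ∀ t ∈ Metric.ball 0 ε, velocity (F := Plane) c t
      = ((5 / 4 : ℝ) • n (c t) + (3 / 4 : ℝ) • τ (c t) : Plane) := fun t ht =>
    (congrArg (fun T : ℝ →L[ℝ] Plane => T 1) (hc t ht).hasMFDerivAt.mfderiv).trans (one_smul ℝ _)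
  have hw : IsWorldline g i (Metric.ball 0 ε) c :=
    ⟨Metric.isOpen_ball, by rw [Real.ball_eq_Ioo]; exact ordConnected_Ioo, hcs, fun t ht => by
      rw [hvel t ht]; exact hu.2 _ (hcU ht)⟩
  obtain ⟨h1, h2⟩ := hN n h.1 _ c hw hcU 0 h0 U hU subset_rfl hp τ h (3 / 5)
    ⟨by norm_num, by norm_num, by
      rw [hvel 0 h0, lorentzFactor_three_fifths]
      change (5 / 4 : ℝ) • n (c 0) + (3 / 4 : ℝ) • τ (c 0)
        = (5 / 4 : ℝ) • (n (c 0) + (3 / 5 : ℝ) • τ (c 0))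
      module⟩
  rw [centrifugal_eq, lorentzFactor_three_fifths] at h1
  rw [coriolis_eq, lorentzFactor_three_fifths] at h2
  exact isPhotonPoint_of_bracket_eq_zero hi.contMDiff hU h hp
    ((smul_eq_zero_iff_right (by norm_num)).1 h2) ((smul_eq_zero_iff_right (by norm_num)).1 h1)

end Equivalences

end PhotonSurface

end

/-! ### The local and global equivalences -/

theorem theorem1 {E : Type*} [NormedAddCommGroup E] [NormedSpace ℝ E] [FiniteDimensional ℝ E]
    {M : Type*} [TopologicalSpace M] [ChartedSpace E M] [IsManifold 𝓘(ℝ, E) ∞ M]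
    {S : Type*} [TopologicalSpace S] [ChartedSpace PhotonSurface.Plane S]
    [IsManifold 𝓘(ℝ, PhotonSurface.Plane) ∞ S]
    (g : PhotonSurface.LorentzMetric E M) (i : S → M)
    (hi : PhotonSurface.IsTimelikeSurface g i) :
    -- vector fields defined on arbitrary open subsets of the surface
    List.TFAE
      [∀ U : Set S, IsOpen U → PhotonSurface.NoCentrifugalCoriolis g i U,
       ∀ p : S, ∃ U : Set S, IsOpen U ∧ p ∈ U ∧
         PhotonSurface.IsGeneratedByLightlikeGeodesics g i U,
       ∀ U : Set S, IsOpen U → PhotonSurface.FermiWalkerParallel g i U] ∧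
    -- vector fields defined on the whole surface, if it carries a global orthonormal pair
    ((∃ n τ : (p : S) → TangentSpace 𝓘(ℝ, PhotonSurface.Plane) p,
        PhotonSurface.IsOrthonormalPair g i Set.univ n τ) →
      List.TFAE
        [PhotonSurface.NoCentrifugalCoriolis g i Set.univ,
         PhotonSurface.IsGeneratedByLightlikeGeodesics g i Set.univ,
         PhotonSurface.FermiWalkerParallel g i Set.univ]) := by
  -- A frame on `U` is essential: without one, (i) and (iii) on `U` could hold vacuously.
  have key : ∀ U : Set S, IsOpen U → ∀ n τ : S → PhotonSurface.Plane,
      PhotonSurface.IsOrthonormalPair g i U n τ →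
      (PhotonSurface.NoCentrifugalCoriolis g i U ∨
        PhotonSurface.IsGeneratedByLightlikeGeodesics g i U ∨
        PhotonSurface.FermiWalkerParallel g i U) →
      ∀ p ∈ U, PhotonSurface.IsPhotonPoint g i p := by
    rintro U hU n τ h (h' | h' | h') p hp
    · exact PhotonSurface.isPhotonPoint_of_noCentrifugalCoriolis hi hU h h' hp
    · exact PhotonSurface.isPhotonPoint_of_isGenerated hi hU h' hp
    · exact PhotonSurface.isPhotonPoint_of_fermiWalkerParallel hi hU h h' hp
  constructor
  · tfae_have 1 → 2 := by
      intro h p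
      obtain ⟨U, n, τ, hU, hp, hnτ⟩ := hi.exists_isOrthonormalPair p
      exact ⟨U, hU, hp, PhotonSurface.isGenerated_of_isPhotonPoint hi hU hnτ
        (key U hU n τ hnτ (.inl (h U hU)))⟩
    tfae_have 2 → 3 := by
      intro h U hU
      refine PhotonSurface.fermiWalkerParallel_of_isPhotonPoint hi hU fun p _ => ?_
      obtain ⟨V, hV, hpV, h'⟩ := h p
      exact PhotonSurface.isPhotonPoint_of_isGenerated hi hV h' hpV
    tfae_have 3 → 1 := by
      intro h U hU
      refine PhotonSurface.noCentrifugalCoriolis_of_isPhotonPoint hi fun p _ => ?_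
      -- `U` itself may carry no frame, so the hypothesis is applied on a small `V` around `p`.
      obtain ⟨V, n, τ, hV, hp, hnτ⟩ := hi.exists_isOrthonormalPair p
      exact key V hV n τ hnτ (.inr (.inr (h V hV))) p hp
    tfae_finish
  · rintro ⟨n, τ, hnτ⟩
    have key' := key Set.univ isOpen_univ n τ hnτ
    tfae_have 1 → 2 := fun h => PhotonSurface.isGenerated_of_isPhotonPoint hi isOpen_univ hnτ
      (key' (.inl h))
    tfae_have 2 → 3 := fun h => PhotonSurface.fermiWalkerParallel_of_isPhotonPoint hi isOpen_univ
      (key' (.inr (.inl h)))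
    tfae_have 3 → 1 := fun h => PhotonSurface.noCentrifugalCoriolis_of_isPhotonPoint hi
      (key' (.inr (.inr h)))
    tfae_finish
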